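/- **Setting.** Let $\mathcal H$ be a separable real Hilbert space with its Borel $\sigma$-algebra and let $k:\mathcal H\times\mathcal H\to\mathbb R$ be a bounded measurable positive semidefinite kernel. For Borel probability measures $P,Q$ on $\mathcal H$ put $$d(P,Q)=\iint k\,dP\,dP+\iint k\,dQ\,dQ-2\iint k(x,y)\,dP(x)\,dQ(y),$$ and assume that $k$ is characteristic, i.e. $d(P,Q)=0$ implies $P=Q$. For two groups $S_1,S_2$ of $r\ge 1$ and $m-r\ge 1$ observations, with empirical distributions $\widehat P_{S_1},\widehat P_{S_2}$, put $\rho(S_1,S_2)=\frac{r(m-r)}{m^2}\,d(\widehat P_{S_1},\widehat P_{S_2})$. Let $\delta_n\in(0,1)$ for $n\ge1$, with $\delta_n\to0$ and $n\delta_n\to\infty$. **Data.** Let $K_0\ge0$, let $0=\gamma^{(0)}<\gamma^{(1)}<\dots<\gamma^{(K_0)}<\gamma^{(K_0+1)}=1$, and let $F_1,\dots,F_{K_0+1}$ be Borel probability measures on $\mathcal H$ with $F_j\ne F_{j+1}$ for $j=1,\dots,K_0$. For every $n$ the dataset $Z_1,\dots,Z_n$ (a row of a triangular array on one probability space $(\Omega,\mathcal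 F,\mathbb P)$; the joint law of different rows is arbitrary) consists of independent $\mathcal H$-valued random variables such that $Z_i\sim F_j$ for $\lfloor n\gamma^{(j-1)}\rfloor<i\le\lfloor n\gamma^{(j)}\rfloor$, $j=1,\dots,K_0+1$. The numbers $\gamma^{(1)},\dots,\gamma^{(K_0)}$ are the true breakfractions. **Algorithm DESC-S** with prescribed number $K\ge1$ of changepoints. Start with the whole dataset as the only segment. In each of $K$ iterations: (1) split every current segment $C$, of size $m$ say, after its first $\widehat\tau$ observations, where $\widehat\tau$ maximises the $\rho$-distance between the first $t$ and the last $m-t$ observations of $C$ over the integers $\lceil m\delta_m\rceil\le t\le\lfloor m(1-\delta_m)\rfloor$; (2) arrange the splits in increasing order of the $\rho$-distances of their two halves; (3) merge the two halves again for every split except the last one in this order (so the number of segments grows by exactly one). Ties are broken in any way. If $C^{(1)},\dots,C^{(K+1)}$ are the final segments in time order, the estimated breakfractions are $\widehat\gamma_{n,K}^{(l)}=\sum_{i=1}^{l}|C^{(i)}|/n$, $l=1,\dots,K$. **Theorem.** For every $K\ge1$ there is $n_0$ such that for all $n\ge n_0$ and whatever the data the algorithm can be carried out (all the maxima are over non-empty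 sets). Moreover, $\mathbb P$-almost surely, however the ties are broken, the following hold as $n\to\infty$. (a) If $K\le K_0$, then $\displaystyle\max_{1\le i\le K}\ \min_{1\le i'\le K_0}\bigl|\widehat\gamma_{n,K}^{(i)}-\gamma^{(i')}\bigr|\to0.$ (b) If $K=K_0$, then $d_H\bigl(\{\widehat\gamma_{n,K}^{(1)},\dots,\widehat\gamma_{n,K}^{(K)}\},\{\gamma^{(1)},\dots,\gamma^{(K_0)}\}\bigr)\to0$, where $d_H$ is the Hausdorff distance. (c) If $K>K_0$, then $\displaystyle\max_{1\le i'\le K_0}\ \min_{1\le i\le K}\bigl|\widehat\gamma_{n,K}^{(i)}-\gamma^{(i')}\bigr|\to0$ (for $K_0=0$ the maximum is read as $0$). -/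

import Mathlib

open MeasureTheory ProbabilityTheory Filter Topology

namespace DescS

noncomputable section

/-- The squared maximum mean discrepancy `d(P, Q)` of two probability measures with respect to
the (bounded) kernel `k`. -/
def mmdSq {H : Type*} [MeasurableSpace H] (k : H → H → ℝ) (P Q : Measure H) : ℝ :=
  (∫ x, ∫ x', k x x' ∂P ∂P) + (∫ y, ∫ y', k y y' ∂Q ∂Q) - 2 * ∫ x, ∫ y, k x y ∂Q ∂P

/-- `k` is a bounded, measurable, positive semidefinite (in particular symmetric) kernel which is
characteristic: the squared maximum mean discrepancy separates Borel probability measures. -/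
structure IsBoundedCharacteristicKernel {H : Type*} [MeasurableSpace H] (k : H → H → ℝ) :
    Prop where
  measurable : Measurable (Function.uncurry k)
  bounded : ∃ B : ℝ, ∀ x y, |k x y| ≤ B
  posSemidef : (Matrix.of k).PosSemidef
  characteristic : ∀ P Q : Measure H, IsProbabilityMeasure P → IsProbabilityMeasure Q →
    mmdSq k P Q = 0 → P = Q

/-- `d` of the empirical distributions of the observations `z i`, `i ∈ S`, and
`z j`, `j ∈ T`. -/
def empMmdSq {H : Type*} (k : H → H → ℝ) (z : ℕ → H) (S T : Finset ℕ) : ℝ :=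
  (1 / (S.card : ℝ) ^ 2) * (∑ i ∈ S, ∑ i' ∈ S, k (z i) (z i'))
    + (1 / (T.card : ℝ) ^ 2) * (∑ j ∈ T, ∑ j' ∈ T, k (z j) (z j'))
    - (2 / ((S.card : ℝ) * (T.card : ℝ))) * (∑ i ∈ S, ∑ j ∈ T, k (z i) (z j))

/-- The distance `ρ` between two groups of observations: if the groups have `r` and `m - r`
elements, it is `r (m - r) / m ^ 2` times `d` of their empirical distributions. -/
def rho {H : Type*} (k : H → H → ℝ) (z : ℕ → H) (S T : Finset ℕ) : ℝ :=
  ((S.card : ℝ) * (T.card : ℝ) / ((S.card : ℝ) + (T.card : ℝ)) ^ 2) * empMmdSq k z S T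

/-- `ρ` between the first `t` observations and the remaining ones of the segment
`z a, …, z (b - 1)`. -/
def splitRho {H : Type*} (k : H → H → ℝ) (z : ℕ → H) (a b t : ℕ) : ℝ :=
  rho k z (Finset.Ico a (a + t)) (Finset.Ico (a + t) b)

/-- The admissible split positions in a segment of size `m`:
`⌈m δ_m⌉ ≤ t ≤ ⌊m (1 - δ_m)⌋`. -/
def splitRange (δ : ℕ → ℝ) (m : ℕ) : Finset ℕ :=
  Finset.Icc ⌈(m : ℝ) * δ m⌉₊ ⌊(m : ℝ) * (1 - δ m)⌋₊

/-- `t` is a changepoint candidate (relative position) of the segment `z a, …, z (b - 1)`: a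
maximiser of `ρ` over the admissible split positions. -/
def IsCandidate {H : Type*} (δ : ℕ → ℝ) (k : H → H → ℝ) (z : ℕ → H) (a b t : ℕ) : Prop :=
  t ∈ splitRange δ (b - a) ∧ ∀ s ∈ splitRange δ (b - a), splitRho k z a b s ≤ splitRho k z a b t

/-- `IsStage δ k z n i c`: Algorithm DESC-S, run on the `n` observations `z 0, …, z (n - 1)`, can
reach after `i` iterations the partition into the `i + 1` consecutive segments
`z (c j), …, z (c (j + 1) - 1)`, `j = 0, …, i`, listed in time order.

In one iteration every segment `j` is split at a candidate `τ j`, the splits are arranged by `σ` in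
increasing order of their `ρ`-values, the two halves are merged again for all splits but the last
one in this order, and the segment of the last one stays split, so that the list of boundaries
gets the new entry `c j + τ j` between `c j` and `c (j + 1)` for `j = σ (last)`. All ways of
breaking ties (among maximisers and among `ρ`-values) are allowed. -/
def IsStage {H : Type*} (δ : ℕ → ℝ) (k : H → H → ℝ) (z : ℕ → H) (n : ℕ) :
    (i : ℕ) → (Fin (i + 2) → ℕ) → Prop
  | 0, c => c = ![0, n]
  | i + 1, c' => ∃ (c : Fin (i + 2) → ℕ) (τ : Fin (i + 1) → ℕ) (σ : Equiv.Perm (Fin (i + 1))),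
      IsStage δ k z n i c ∧
      (∀ j : Fin (i + 1), IsCandidate δ k z (c j.castSucc) (c j.succ) (τ j)) ∧
      Monotone (fun r : Fin (i + 1) =>
        splitRho k z (c (σ r).castSucc) (c (σ r).succ) (τ (σ r))) ∧
      c' = Fin.insertNth (α := fun _ => ℕ) (σ (Fin.last i)).succ.castSucc
        (c (σ (Fin.last i)).castSucc + τ (σ (Fin.last i))) c

/-- The estimated breakfractions `(|C^(1)| + ⋯ + |C^(l)|) / n`, `l = 1, …, K`, of the partition of
`n` observations into `K + 1` consecutive segments with boundaries `c`
(the index `l : Fin K` stands for `l + 1`). -/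
def estBreak {K : ℕ} (n : ℕ) (c : Fin (K + 2) → ℕ) (l : Fin K) : ℝ :=
  (c l.succ.castSucc : ℝ) / (n : ℝ)

/-- The true breakfractions `γ^(1), …, γ^(K₀)` out of `γ^(0), …, γ^(K₀ + 1)`
(the index `i : Fin K₀` stands for `i + 1`). -/
def trueBreak {K₀ : ℕ} (γ : Fin (K₀ + 2) → ℝ) (i : Fin K₀) : ℝ :=
  γ i.succ.castSucc

/-- The multiple changepoint setting with `K₀` changepoints. Row `n` of the array `Z` is the dataset
of size `n`: `Z n 0, …, Z n (n - 1)` are the observations `Z_1, …, Z_n`. They are independent, and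
`Z_i` has law `F_{j + 1}` if `⌊n γ^(j)⌋ < i ≤ ⌊n γ^(j + 1)⌋`. Nothing is assumed on the joint
law of different rows. -/
structure IsChangepointModel {H Ω : Type*} [MeasurableSpace H] [MeasurableSpace Ω]
    (μ : Measure Ω) (K₀ : ℕ) (γ : Fin (K₀ + 2) → ℝ) (F : Fin (K₀ + 1) → Measure H)
    (Z : ℕ → ℕ → Ω → H) : Prop where
  strictMono : StrictMono γ
  gamma_zero : γ 0 = 0
  gamma_last : γ (Fin.last (K₀ + 1)) = 1
  isProbabilityMeasure : ∀ j, IsProbabilityMeasure (F j)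
  ne : ∀ j : Fin K₀, F j.castSucc ≠ F j.succ
  measurable : ∀ n i, i < n → Measurable (Z n i)
  indep : ∀ n, iIndepFun (fun i : Fin n => Z n i) μ
  law : ∀ (n : ℕ) (j : Fin (K₀ + 1)) (i : ℕ), ⌊(n : ℝ) * γ j.castSucc⌋₊ ≤ i →
    i < ⌊(n : ℝ) * γ j.succ⌋₊ → μ.map (Z n i) = F j

end

end DescS

/-!
Everything the algorithm computes is a function of double kernel sums `∑ i < p, ∑ j < q, k (z i) (z j)`,
and the proof first replaces these by a deterministic limit and then analyses the limit.

*Probability.* For a fixed observation `Z i = x`, the sum of `k x (Z j)` over `j ≠ i` is a sum of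
bounded independent variables, so Hoeffding's inequality applies conditionally on `Z i`; a second
application handles the remaining average over `i`. The bounds are exponential in `n`, hence the
union over all `i`, `p`, `q ≤ n` is still summable, and Borel–Cantelli gives an almost sure uniform
law (`ae_forall_eventually_abs_sum_sum_le`). It needs no relation between different rows of the
array and no continuity of `k`.

*Limit of the criterion.* The matrix `∬ k dF_a dF_b` is a limit of block sums of positive
semidefinite matrices, hence the Gram matrix of vectors `v a` in a Euclidean space, and `k` being
characteristic means `v a ≠ v (a + 1)`. Let `W` be the piecewise linear path with velocity `v a` on
`[γ a, γ (a + 1)]`. Double sums over index intervals, divided by `n ^ 2`, converge to inner products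
of increments of `W`, so `splitRho` converges to the explicit function `splitLimit W x y θ` of the
limiting end points `x < y` and split point `θ`
(`IsGramApprox.tendsto_splitRho`). Near the ends of the segment the weight of `ρ` tends to zero, which
is why `δ m → 0` does no harm there.

*Analysis of the limit.* Up to a constant, `splitLimit` is `‖f θ‖ ^ 2 / ((θ - x) * (y - θ))` with `f`
affine wherever `W` is. At a positive maximum inside a linear piece the quadratic
`‖f θ‖ ^ 2 - M * (θ - x) * (y - θ)` would be strictly convex with a local maximum, which is impossible:
positive maximisers are breakfractions. If a breakfraction lies in the segment, `f` has a kink there,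
so the maximum is positive.

*The algorithm.* Limits are taken along ultrafilters finer than `atTop`, along which all rescaled
boundaries converge and all finite choices (the orderings of the splits) are eventually constant.
As long as fewer than `K₀` iterations are done, some limiting segment still contains a breakfraction,
so the split with the largest `ρ`-value is positive in the limit and adds a new breakfraction
(`IsGramApprox.exists_tendsto_stage`). After `K₀` iterations all of them are found, and later
iterations only add boundaries.
-/

/-! ### Concentration of double kernel sums -/

namespace DescS

/-- Two-sided Hoeffding inequality. The number of summands enters only through an upper bound `N`,
which makes the estimate uniform over subsets of a row. -/
theorem measure_abs_sum_sub_integral_ge_le {Ω ι : Type*} [MeasurableSpace Ω] {μ : Measure Ω}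
    [IsProbabilityMeasure μ] {X : ι → Ω → ℝ} (hindep : iIndepFun X μ)
    (hX : ∀ i, Measurable (X i)) {B : ℝ} (hB : 0 < B) (hXB : ∀ i ω, |X i ω| ≤ B)
    (S : Finset ι) {N : ℕ} (hS : S.card ≤ N) {t : ℝ} (ht : 0 < t) :
    μ {ω | t ≤ |∑ i ∈ S, (X i ω - ∫ ω', X i ω' ∂μ)|}
      ≤ ENNReal.ofReal (2 * Real.exp (-t ^ 2 / (2 * (N * B ^ 2)))) := by
  rcases S.eq_empty_or_nonempty with rfl | hne
  · simp [not_le.2 ht]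
  have hcard : (0 : ℝ) < S.card := by exact_mod_cast hne.card_pos
  have hsub : ∀ i, HasSubgaussianMGF (fun ω => X i ω - ∫ ω', X i ω' ∂μ)
      ((‖B - -B‖₊ / 2) ^ 2) μ := fun i =>
    hasSubgaussianMGF_of_mem_Icc (hX i).aemeasurable
      (ae_of_all _ fun ω => ⟨(abs_le.1 (hXB i ω)).1, (abs_le.1 (hXB i ω)).2⟩)
  have hc : (((‖B - -B‖₊ / 2) ^ 2 : NNReal) : ℝ) = B ^ 2 := by
    have : ‖B - -B‖ = 2 * B := by rw [Real.norm_of_nonneg] <;> linarith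
    push_cast
    rw [this]
    ring
  have hind : iIndepFun (fun i ω => X i ω - ∫ ω', X i ω' ∂μ) μ :=
    hindep.comp (fun i x => x - ∫ ω', X i ω' ∂μ) (fun i => by fun_prop)
  have hindn : iIndepFun (fun i => -(fun ω => X i ω - ∫ ω', X i ω' ∂μ)) μ :=
    hindep.comp (fun i x => -(x - ∫ ω', X i ω' ∂μ)) (fun i => by fun_prop)
  have hexp : Real.exp (-t ^ 2 / (2 * (S.card * B ^ 2)))
      ≤ Real.exp (-t ^ 2 / (2 * (N * B ^ 2))) := by
    rw [Real.exp_le_exp, neg_div, neg_div, neg_le_neg_iff]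
    have : (S.card : ℝ) ≤ N := by exact_mod_cast hS
    gcongr
  have h1 := HasSubgaussianMGF.measure_sum_ge_le_of_iIndepFun hind (s := S)
    (fun i _ => hsub i) ht.le
  have h2 := HasSubgaussianMGF.measure_sum_ge_le_of_iIndepFun hindn (s := S)
    (fun i _ => (hsub i).neg) ht.le
  simp only [Finset.sum_const, nsmul_eq_mul, NNReal.coe_mul, NNReal.coe_natCast, hc] at h1 h2
  rw [← ofReal_measureReal]
  apply ENNReal.ofReal_le_ofReal
  calc _ ≤ μ.real ({ω | t ≤ ∑ i ∈ S, (X i ω - ∫ ω', X i ω' ∂μ)} ∪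
        {ω | t ≤ ∑ i ∈ S, (-(fun ω => X i ω - ∫ ω', X i ω' ∂μ)) ω}) := by
        refine measureReal_mono ?_
        intro ω hω
        rcases le_abs.1 (show t ≤ |_| from hω) with h | h
        · exact Or.inl h
        · refine Or.inr ?_
          simpa [← Finset.sum_neg_distrib] using h
    _ ≤ _ := (measureReal_union_le _ _).trans (by linarith)

theorem measurable_integral_kernel {H : Type*} [MeasurableSpace H] {k : H → H → ℝ}
    (hk : Measurable (Function.uncurry k)) (ν : Measure H) [SFinite ν] :
    Measurable fun x => ∫ y, k x y ∂ν :=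
  (hk.stronglyMeasurable.integral_prod_right' (ν := ν)).measurable

/-- Hoeffding's inequality conditionally on `X i`: by independence the joint law of `X i` and
`(X j)_{j ∈ S}` is a product measure, and for each value of `X i` the unconditional bound applies. -/
theorem measure_abs_sum_kernel_sub_integral_ge_le {Ω ι H : Type*} [MeasurableSpace Ω]
    [MeasurableSpace H] {μ : Measure Ω} [IsProbabilityMeasure μ] {X : ι → Ω → H}
    (hindep : iIndepFun X μ) (hX : ∀ i, Measurable (X i)) {k : H → H → ℝ}
    (hk : Measurable (Function.uncurry k)) {B : ℝ} (hB : 0 < B) (hkB : ∀ x y, |k x y| ≤ B)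
    {i : ι} {S : Finset ι} (hi : i ∉ S) {N : ℕ} (hS : S.card ≤ N) {t : ℝ} (ht : 0 < t) :
    μ {ω | t ≤ |∑ j ∈ S, (k (X i ω) (X j ω) - ∫ y, k (X i ω) y ∂(μ.map (X j)))|}
      ≤ ENNReal.ofReal (2 * Real.exp (-t ^ 2 / (2 * (N * B ^ 2)))) := by
  classical
  have hprob : ∀ j, IsProbabilityMeasure (μ.map (X j)) :=
    fun j => Measure.isProbabilityMeasure_map (hX j).aemeasurable
  let Y : Ω → S → H := fun ω j => X j ω
  have hY : Measurable Y := measurable_pi_lambda _ fun j => hX j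
  have hXY : IndepFun (X i) Y μ := by
    have h := hindep.indepFun_finset {i} S (by simpa using hi) hX
    exact h.comp (φ := fun f : ({i} : Finset ι) → H => f ⟨i, by simp⟩) (ψ := id)
      (measurable_pi_apply _) measurable_id
  let A : Set (H × (S → H)) :=
    {p | t ≤ |∑ j : S, (k p.1 (p.2 j) - ∫ y, k p.1 y ∂(μ.map (X j)))|}
  have hA : MeasurableSet A := by
    refine measurableSet_le measurable_const ?_
    have : Measurable fun p : H × (S → H) =>
        ∑ j : S, (k p.1 (p.2 j) - ∫ y, k p.1 y ∂(μ.map (X j))) := by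
      refine Finset.measurable_sum _ fun j _ => Measurable.sub ?_ ?_
      · exact hk.comp (measurable_fst.prodMk ((measurable_pi_apply j).comp measurable_snd))
      · exact (measurable_integral_kernel hk _).comp measurable_fst
    exact this.abs
  have hset : {ω | t ≤ |∑ j ∈ S, (k (X i ω) (X j ω) - ∫ y, k (X i ω) y ∂(μ.map (X j)))|}
      = (fun ω => (X i ω, Y ω)) ⁻¹' A := by
    ext ω
    simp only [A, Y, Set.mem_ofPred_eq, Set.mem_preimage]
    rw [Finset.sum_coe_sort S
      (fun j => k (X i ω) (X j ω) - ∫ y, k (X i ω) y ∂(μ.map (X j)))]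
  have hmY : IsProbabilityMeasure (μ.map Y) := Measure.isProbabilityMeasure_map hY.aemeasurable
  have := hprob i
  rw [hset, ← Measure.map_apply ((hX i).prodMk hY) hA,
    (indepFun_iff_map_prod_eq_prod_map_map (hX i).aemeasurable hY.aemeasurable).1 hXY,
    Measure.prod_apply hA]
  refine (lintegral_mono (g := fun _ => _) fun x => ?_).trans
    (b := ∫⁻ _, ENNReal.ofReal (2 * Real.exp (-t ^ 2 / (2 * (N * B ^ 2)))) ∂(μ.map (X i))) (by simp)
  rw [Measure.map_apply hY (measurable_prodMk_left hA)]
  have hkx : Measurable (k x) := hk.comp measurable_prodMk_left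
  have h := measure_abs_sum_sub_integral_ge_le (X := fun j ω => k x (X j ω))
    (hindep.comp (fun _ => k x) fun _ => hkx) (fun j => hkx.comp (hX j)) hB
    (fun j ω => hkB _ _) S hS ht
  refine le_trans (le_of_eq ?_) h
  congr 1
  ext ω
  simp only [A, Y, Set.mem_ofPred_eq, Set.mem_preimage]
  rw [Finset.sum_coe_sort S (fun j => k x (X j ω) - ∫ y, k x y ∂(μ.map (X j)))]
  simp_rw [integral_map (hX _).aemeasurable hkx.aestronglyMeasurable]

/-- The expected kernel value `∬ k dP dQ`. -/
noncomputable def meanKernel {H : Type*} [MeasurableSpace H] (k : H → H → ℝ) (P Q : Measure H) :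
    ℝ :=
  ∫ x, ∫ y, k x y ∂Q ∂P

theorem abs_integral_kernel_le {H : Type*} [MeasurableSpace H] {k : H → H → ℝ} {B : ℝ}
    (hkB : ∀ x y, |k x y| ≤ B) (ν : Measure H) [IsProbabilityMeasure ν] (x : H) :
    |∫ y, k x y ∂ν| ≤ B := by
  have := norm_integral_le_of_norm_le_const (μ := ν) (f := k x) (C := B)
    (ae_of_all _ fun y => hkB x y)
  simpa using this

/-- Splitting `k (x i) (x j) - M i j` at the partial integral `h j (x i)`. The diagonal, where the two
arguments of `k` are not independent, is left out of `hT` and contributes the term `2 * B`. -/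
theorem abs_sum_sum_le_of_abs_sum_le {ι H : Type*} [Fintype ι] [DecidableEq ι] {k : H → H → ℝ}
    {B : ℝ} (hkB : ∀ x y, |k x y| ≤ B) {h : ι → H → ℝ} (hhB : ∀ j x, |h j x| ≤ B)
    {M : ι → ι → ℝ} {x : ι → H} {S T : Finset ι} {t : ℝ}
    (hT : ∀ i, |∑ j ∈ T.erase i, (k (x i) (x j) - h j (x i))| ≤ t)
    (hS : ∀ j, |∑ i ∈ S, (h j (x i) - M i j)| ≤ t) :
    |∑ i ∈ S, ∑ j ∈ T, (k (x i) (x j) - M i j)| ≤ Fintype.card ι * (2 * t + 2 * B) := by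
  have hdec : ∑ i ∈ S, ∑ j ∈ T, (k (x i) (x j) - M i j)
      = ∑ i ∈ S, ∑ j ∈ T, (k (x i) (x j) - h j (x i)) + ∑ j ∈ T, ∑ i ∈ S, (h j (x i) - M i j) := by
    rw [Finset.sum_comm (s := T), ← Finset.sum_add_distrib]
    refine Finset.sum_congr rfl fun i _ => ?_
    rw [← Finset.sum_add_distrib]
    exact Finset.sum_congr rfl fun j _ => by ring
  have hrow : ∀ i, |∑ j ∈ T, (k (x i) (x j) - h j (x i))| ≤ t + 2 * B := by
    intro i
    have hi : |k (x i) (x i) - h i (x i)| ≤ 2 * B :=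
      (abs_sub _ _).trans (by linarith [hkB (x i) (x i), hhB i (x i)])
    by_cases hiT : i ∈ T
    · rw [← Finset.sum_erase_add _ _ hiT]
      exact (abs_add_le _ _).trans (add_le_add (hT i) hi)
    · have := hT i
      rw [Finset.erase_eq_of_notMem hiT] at this
      linarith [abs_nonneg (k (x i) (x i) - h i (x i))]
  have bound : ∀ (R : Finset ι) (f : ι → ℝ) (c : ℝ), 0 ≤ c → (∀ i, |f i| ≤ c) →
      |∑ i ∈ R, f i| ≤ Fintype.card ι * c := by
    intro R f c hc hf
    calc |∑ i ∈ R, f i| ≤ ∑ i ∈ R, |f i| := Finset.abs_sum_le_sum_abs _ _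
      _ ≤ ∑ i ∈ R, c := Finset.sum_le_sum fun i _ => hf i
      _ = R.card * c := by simp
      _ ≤ _ := by
        have : (R.card : ℝ) ≤ Fintype.card ι := by exact_mod_cast Finset.card_le_univ R
        gcongr
  rcases isEmpty_or_nonempty ι with hι | ⟨⟨i₀⟩⟩
  · simp [Finset.eq_empty_of_isEmpty S]
  have ht : 0 ≤ t := (abs_nonneg _).trans (hS i₀)
  have hB : 0 ≤ t + 2 * B := (abs_nonneg _).trans (hrow i₀)
  rw [hdec]
  refine (abs_add_le _ _).trans ?_
  have h1 := bound S _ _ hB hrow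
  have h2 := bound T _ _ ht hS
  linarith

/-- Union bound over a finite family `C` of index sets. -/
theorem measure_exists_abs_sum_sum_gt_le {Ω ι H : Type*} [Fintype ι] [MeasurableSpace Ω]
    [MeasurableSpace H] {μ : Measure Ω} [IsProbabilityMeasure μ] {X : ι → Ω → H}
    (hindep : iIndepFun X μ) (hX : ∀ i, Measurable (X i)) {k : H → H → ℝ}
    (hk : Measurable (Function.uncurry k)) {B : ℝ} (hB : 0 < B) (hkB : ∀ x y, |k x y| ≤ B)
    (C : Finset (Finset ι)) {t : ℝ} (ht : 0 < t) :
    μ {ω | ∃ S ∈ C, ∃ T ∈ C, Fintype.card ι * (2 * t + 2 * B) <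
        |∑ i ∈ S, ∑ j ∈ T, (k (X i ω) (X j ω) - meanKernel k (μ.map (X i)) (μ.map (X j)))|}
      ≤ ENNReal.ofReal (4 * Fintype.card ι * C.card *
          Real.exp (-t ^ 2 / (2 * (Fintype.card ι * B ^ 2)))) := by
  classical
  have hprob : ∀ j, IsProbabilityMeasure (μ.map (X j)) :=
    fun j => Measure.isProbabilityMeasure_map (hX j).aemeasurable
  set N := Fintype.card ι
  set h : ι → H → ℝ := fun j x => ∫ y, k x y ∂(μ.map (X j)) with hh
  have hhm : ∀ j, Measurable (h j) := fun j => measurable_integral_kernel hk _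
  have hhB : ∀ j x, |h j x| ≤ B := fun j x => abs_integral_kernel_le hkB _ x
  set e := ENNReal.ofReal (2 * Real.exp (-t ^ 2 / (2 * (N * B ^ 2)))) with he
  let A : ι → Finset ι → Set Ω := fun i T =>
    {ω | t ≤ |∑ j ∈ T.erase i, (k (X i ω) (X j ω) - h j (X i ω))|}
  let A' : ι → Finset ι → Set Ω := fun j S =>
    {ω | t ≤ |∑ i ∈ S, (h j (X i ω) - meanKernel k (μ.map (X i)) (μ.map (X j)))|}
  have hA : ∀ i T, μ (A i T) ≤ e := fun i T =>
    measure_abs_sum_kernel_sub_integral_ge_le hindep hX hk hB hkB (Finset.notMem_erase i T)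
      (Finset.card_le_univ _) ht
  have hA' : ∀ j S, μ (A' j S) ≤ e := by
    intro j S
    have := measure_abs_sum_sub_integral_ge_le (X := fun i ω => h j (X i ω))
      (hindep.comp (fun _ => h j) fun _ => hhm j) (fun i => (hhm j).comp (hX i)) hB
      (fun i ω => hhB _ _) S (Finset.card_le_univ S) ht
    have hint : ∀ i, ∫ ω, h j (X i ω) ∂μ = meanKernel k (μ.map (X i)) (μ.map (X j)) := fun i =>
      (integral_map (hX i).aemeasurable (hhm j).aestronglyMeasurable).symm
    simp only [hint] at this
    exact this
  calc _ ≤ μ ((⋃ i ∈ (Finset.univ : Finset ι), ⋃ T ∈ C, A i T) ∪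
        (⋃ i ∈ (Finset.univ : Finset ι), ⋃ T ∈ C, A' i T)) := by
        refine measure_mono ?_
        rintro ω ⟨S, hS, T, hT, hlt⟩
        by_contra hcon
        simp only [Set.mem_union, Set.mem_iUnion, not_or, not_exists] at hcon
        refine absurd hlt (not_lt.2 (abs_sum_sum_le_of_abs_sum_le hkB hhB
          (fun i => ?_) (fun j => ?_)))
        · exact (not_le.1 (hcon.1 i (Finset.mem_univ _) T hT)).le
        · exact (not_le.1 (hcon.2 j (Finset.mem_univ _) S hS)).le
    _ ≤ (∑ i : ι, ∑ T ∈ C, μ (A i T)) + ∑ i : ι, ∑ T ∈ C, μ (A' i T) := by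
        refine (measure_union_le _ _).trans (add_le_add ?_ ?_)
        · exact (measure_biUnion_finset_le _ _).trans
            (Finset.sum_le_sum fun i _ => measure_biUnion_finset_le _ _)
        · exact (measure_biUnion_finset_le _ _).trans
            (Finset.sum_le_sum fun i _ => measure_biUnion_finset_le _ _)
    _ ≤ (∑ i : ι, ∑ T ∈ C, e) + ∑ i : ι, ∑ T ∈ C, e := by
        gcongr <;> [exact hA _ _; exact hA' _ _]
    _ = _ := by
        simp only [Finset.sum_const, nsmul_eq_mul, Finset.card_univ]
        rw [he, ← ENNReal.ofReal_natCast, ← ENNReal.ofReal_natCast, ← ENNReal.ofReal_mul (by positivity),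
          ← ENNReal.ofReal_mul (by positivity), ← ENNReal.ofReal_add (by positivity) (by positivity)]
        congr 1
        ring

theorem sum_range_eq_sum_fin_filter {M : Type*} [AddCommMonoid M] {p n : ℕ} (hp : p ≤ n)
    (f : ℕ → M) :
    ∑ i ∈ Finset.range p, f i = ∑ i : Fin n with i.val < p, f i := by
  have h : Finset.range p = (Finset.range n).filter (· < p) := by
    ext i; simp; omega
  rw [h, Finset.sum_filter, Finset.sum_range, Finset.sum_filter]

/-- Uniform strong law for the double kernel sums of a triangular array with independent rows. The
joint law of different rows is arbitrary, as only the first Borel–Cantelli lemma is used. -/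
theorem ae_forall_eventually_abs_sum_sum_le {Ω H : Type*} [MeasurableSpace Ω]
    [MeasurableSpace H] {μ : Measure Ω} [IsProbabilityMeasure μ] {Z : ℕ → ℕ → Ω → H}
    (hindep : ∀ n, iIndepFun (fun i : Fin n => Z n i) μ)
    (hZ : ∀ n i, i < n → Measurable (Z n i)) {k : H → H → ℝ}
    (hk : Measurable (Function.uncurry k)) {B : ℝ} (hB : 0 < B) (hkB : ∀ x y, |k x y| ≤ B) :
    ∀ᵐ ω ∂μ, ∀ ε > 0, ∀ᶠ n : ℕ in atTop, ∀ p ≤ n, ∀ q ≤ n,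
      |∑ i ∈ Finset.range p, ∑ j ∈ Finset.range q, (k (Z n i ω) (Z n j ω)
        - meanKernel k (μ.map (Z n i)) (μ.map (Z n j)))| ≤ ε * (n : ℝ) ^ 2 := by
  have key : ∀ ε : ℝ, 0 < ε → ∀ᵐ ω ∂μ, ∀ᶠ n : ℕ in atTop, ∀ p ≤ n, ∀ q ≤ n,
      |∑ i ∈ Finset.range p, ∑ j ∈ Finset.range q, (k (Z n i ω) (Z n j ω)
        - meanKernel k (μ.map (Z n i)) (μ.map (Z n j)))| ≤ n * (2 * (ε * n) + 2 * B) := by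
    intro ε hε
    -- The index sets `{i | i < p}`, `p ≤ n`.
    let D : ∀ n : ℕ, Finset (Finset (Fin n)) := fun n =>
      (Finset.range (n + 1)).image fun p => Finset.univ.filter fun i : Fin n => i.val < p
    have hD : ∀ n, (D n).card ≤ n + 1 := fun n =>
      Finset.card_image_le.trans (by simp)
    let bad : ℕ → Set Ω := fun n => {ω | ∃ S ∈ D n, ∃ T ∈ D n,
      Fintype.card (Fin n) * (2 * (ε * n) + 2 * B) <
        |∑ i ∈ S, ∑ j ∈ T, (k (Z n i ω) (Z n j ω)
          - meanKernel k (μ.map (Z n i)) (μ.map (Z n j)))|}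
    let r : ℝ := ε ^ 2 / (2 * B ^ 2)
    have hr : 0 < r := by positivity
    have hbad : ∀ n : ℕ, μ (bad n) ≤ ENNReal.ofReal (8 * ((n : ℝ) ^ 2 * Real.exp (-r * n))) := by
      intro n
      rcases Nat.eq_zero_or_pos n with rfl | hn
      · simp [bad, Finset.sum_of_isEmpty]
      have hn' : (1 : ℝ) ≤ n := by exact_mod_cast hn
      refine (measure_exists_abs_sum_sum_gt_le (X := fun i : Fin n => Z n i) (hindep n)
        (fun i => hZ n i i.2) hk hB hkB (D n) (t := ε * n) (by positivity)).trans ?_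
      apply ENNReal.ofReal_le_ofReal
      have h1 : ((D n).card : ℝ) ≤ 2 * n := by
        have : ((D n).card : ℝ) ≤ n + 1 := by exact_mod_cast hD n
        linarith
      have h2 : -(ε * n) ^ 2 / (2 * (Fintype.card (Fin n) * B ^ 2)) = -r * n := by
        simp only [Fintype.card_fin, r]
        field_simp
      rw [h2, Fintype.card_fin]
      calc _ ≤ 4 * (n : ℝ) * (2 * n) * Real.exp (-r * n) := by gcongr
        _ = _ := by ring
    have hsum : ∑' n, μ (bad n) ≠ ⊤ := by
      refine ne_top_of_le_ne_top ?_ (ENNReal.tsum_le_tsum hbad)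
      exact ((Real.summable_pow_mul_exp_neg_nat_mul 2 hr).mul_left 8).tsum_ofReal_ne_top
    filter_upwards [ae_eventually_notMem hsum] with ω hω
    filter_upwards [hω] with n hn p hp q hq
    by_contra hcon
    refine hn ⟨_, Finset.mem_image_of_mem _ (Finset.mem_range.2 (Nat.lt_succ_of_le hp)), _,
      Finset.mem_image_of_mem _ (Finset.mem_range.2 (Nat.lt_succ_of_le hq)), ?_⟩
    rw [not_le, sum_range_eq_sum_fin_filter hp] at hcon
    simp_rw [sum_range_eq_sum_fin_filter hq] at hcon
    simpa using hcon
  have hall : ∀ᵐ ω ∂μ, ∀ m : ℕ, ∀ᶠ n : ℕ in atTop, ∀ p ≤ n, ∀ q ≤ n,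
      |∑ i ∈ Finset.range p, ∑ j ∈ Finset.range q, (k (Z n i ω) (Z n j ω)
        - meanKernel k (μ.map (Z n i)) (μ.map (Z n j)))|
        ≤ n * (2 * (1 / (m + 1 : ℝ) * n) + 2 * B) :=
    ae_all_iff.2 fun m => key _ (by positivity)
  filter_upwards [hall] with ω hω ε hε
  obtain ⟨m, hm⟩ := exists_nat_one_div_lt (show (0 : ℝ) < ε / 4 by positivity)
  filter_upwards [hω m, eventually_ge_atTop ⌈4 * B / ε⌉₊] with n hn hnB p hp q hq
  refine (hn p hp q hq).trans ?_
  have h1 : 4 * B ≤ ε * n := by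
    have := (div_le_iff₀ hε).1 (Nat.ceil_le.1 hnB)
    linarith
  have h2 : 1 / (m + 1 : ℝ) * n ≤ ε / 4 * n := by gcongr
  calc (n : ℝ) * (2 * (1 / (m + 1 : ℝ) * n) + 2 * B) ≤ n * (ε * n) := by gcongr; linarith
    _ = _ := by ring

/-! ### Block sums and the limiting Gram kernel -/

/-- The length of the part of the `a`-th interval `[u a, u (a + 1)]` of an increasing grid `u` that
lies to the left of `x`. It is used both for the grid `γ` and for the integer grid `⌊n γ⌋`. -/
noncomputable def blockLen {N : ℕ} (u : Fin (N + 1) → ℝ) (a : Fin N) (x : ℝ) : ℝ :=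
  min x (u a.succ) - min x (u a.castSucc)

theorem sum_sum_Ico_succ {M : Type*} [AddCommMonoid M] {N : ℕ} {w : Fin (N + 1) → ℕ}
    (hw : Monotone w) (f : ℕ → M) :
    ∑ a : Fin N, ∑ i ∈ Finset.Ico (w a.castSucc) (w a.succ), f i
      = ∑ i ∈ Finset.Ico (w 0) (w (Fin.last N)), f i := by
  induction N with
  | zero => simp
  | succ N ih =>
    rw [Fin.sum_univ_castSucc]
    have h := ih (w := fun i => w i.castSucc) (fun i j hij => hw (by simpa using hij))
    simp only [Fin.succ_castSucc, Fin.castSucc_zero] at h ⊢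
    rw [h, Finset.sum_Ico_consecutive f (hw (Fin.zero_le _)) (hw (Fin.castSucc_le_succ _))]
    simp

theorem sum_range_eq_sum_blockLen {N : ℕ} {u : Fin (N + 1) → ℕ} (hu : Monotone u) (hu0 : u 0 = 0)
    {p : ℕ} (hp : p ≤ u (Fin.last N)) {f : ℕ → ℝ} {g : Fin N → ℝ}
    (hfg : ∀ a i, u a.castSucc ≤ i → i < u a.succ → f i = g a) :
    ∑ i ∈ Finset.range p, f i = ∑ a, blockLen (fun i => (u i : ℝ)) a p * g a := by
  have h := sum_sum_Ico_succ (w := fun i => min p (u i))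
    (fun i j hij => min_le_min_left p (hu hij)) f
  simp only [hu0, Nat.min_zero, min_eq_left hp, ← Finset.range_eq_Ico] at h
  rw [← h]
  refine Finset.sum_congr rfl fun a _ => ?_
  have hmono : min p (u a.castSucc) ≤ min p (u a.succ) :=
    min_le_min_left p (hu (Fin.castSucc_le_succ a))
  rw [Finset.sum_congr rfl (g := fun _ => g a), Finset.sum_const, nsmul_eq_mul, Nat.card_Ico,
    Nat.cast_sub hmono]
  · simp [blockLen]
  · intro i hi
    rw [Finset.mem_Ico] at hi
    exact hfg a i (by omega) (by omega)

theorem sum_sum_range_eq_sum_sum_blockLen {N : ℕ} {u : Fin (N + 1) → ℕ} (hu : Monotone u)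
    (hu0 : u 0 = 0) {p q : ℕ} (hp : p ≤ u (Fin.last N)) (hq : q ≤ u (Fin.last N))
    {m : ℕ → ℕ → ℝ} {κ : Fin N → Fin N → ℝ}
    (hm : ∀ a b i j, u a.castSucc ≤ i → i < u a.succ → u b.castSucc ≤ j → j < u b.succ →
      m i j = κ a b) :
    ∑ i ∈ Finset.range p, ∑ j ∈ Finset.range q, m i j
      = ∑ a, ∑ b, blockLen (fun i => (u i : ℝ)) a p * blockLen (fun i => (u i : ℝ)) b q
          * κ a b := by
  rw [sum_range_eq_sum_blockLen hu hu0 hp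
    (g := fun a => ∑ b, blockLen (fun i => (u i : ℝ)) b q * κ a b)]
  · simp_rw [Finset.mul_sum, mul_assoc]
  · intro a i h1 h2
    exact sum_range_eq_sum_blockLen hu hu0 hq fun b j h3 h4 => hm a b i j h1 h2 h3 h4

theorem tendsto_floor_mul_div {a : ℝ} (ha : 0 ≤ a) {l : Filter ℕ} (hl : l ≤ atTop) :
    Tendsto (fun n : ℕ => (⌊(n : ℝ) * a⌋₊ : ℝ) / n) l (𝓝 a) := by
  have h := (tendsto_nat_floor_mul_div_atTop ha).comp (tendsto_natCast_atTop_atTop (R := ℝ))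
  exact (h.congr fun n => by simp [mul_comm]).mono_left hl

theorem tendsto_blockLen_div {N : ℕ} {γ : Fin (N + 1) → ℝ} (hγ : ∀ i, 0 ≤ γ i)
    {l : Filter ℕ} (hl : l ≤ atTop) {p : ℕ → ℕ} {x : ℝ}
    (hp : Tendsto (fun n => (p n : ℝ) / n) l (𝓝 x)) (a : Fin N) :
    Tendsto (fun n : ℕ => blockLen (fun i => (⌊(n : ℝ) * γ i⌋₊ : ℝ)) a (p n) / n) l
      (𝓝 (blockLen γ a x)) := by
  have hfloor : ∀ i, Tendsto (fun n : ℕ => (⌊(n : ℝ) * γ i⌋₊ : ℝ) / n) l (𝓝 (γ i)) :=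
    fun i => tendsto_floor_mul_div (hγ i) hl
  have h := (hp.min (hfloor a.succ)).sub (hp.min (hfloor a.castSucc))
  refine h.congr fun n => ?_
  rw [blockLen, sub_div, min_div_div_right (Nat.cast_nonneg n),
    min_div_div_right (Nat.cast_nonneg n)]

/-- The deterministic content of the uniform strong law: row `z n` has double kernel sums which,
uniformly in the ranges of summation and up to `o(n ^ 2)`, are those of the matrix `m n`, and `m n i j`
is `κ a b` if `i` and `j` belong to the `a`-th and the `b`-th block of the grid `⌊n γ⌋`, where `γ` is a
grid of `[0, 1]`. -/
structure IsGramApprox {H : Type*} {N : ℕ} (k : H → H → ℝ) (z : ℕ → ℕ → H)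
    (γ : Fin (N + 1) → ℝ) (κ : Fin N → Fin N → ℝ) (m : ℕ → ℕ → ℕ → ℝ) : Prop where
  strictMono : StrictMono γ
  zero : γ 0 = 0
  last : γ (Fin.last N) = 1
  approx : ∀ ε > 0, ∀ᶠ n : ℕ in atTop, ∀ p ≤ n, ∀ q ≤ n,
    |∑ i ∈ Finset.range p, ∑ j ∈ Finset.range q, (k (z n i) (z n j) - m n i j)|
      ≤ ε * (n : ℝ) ^ 2
  block : ∀ (n : ℕ) a b i j, ⌊(n : ℝ) * γ a.castSucc⌋₊ ≤ i → i < ⌊(n : ℝ) * γ a.succ⌋₊ →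
    ⌊(n : ℝ) * γ b.castSucc⌋₊ ≤ j → j < ⌊(n : ℝ) * γ b.succ⌋₊ → m n i j = κ a b

namespace IsGramApprox

variable {H : Type*} {N : ℕ} {k : H → H → ℝ} {z : ℕ → ℕ → H} {γ : Fin (N + 1) → ℝ}
  {κ : Fin N → Fin N → ℝ} {m : ℕ → ℕ → ℕ → ℝ}

theorem nonneg (h : IsGramApprox k z γ κ m) (i : Fin (N + 1)) : 0 ≤ γ i := by
  rw [← h.zero]
  exact h.strictMono.monotone (Fin.zero_le i)

theorem le_one (h : IsGramApprox k z γ κ m) (i : Fin (N + 1)) : γ i ≤ 1 := by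
  rw [← h.last]
  exact h.strictMono.monotone (Fin.le_last i)

theorem tendsto_sum_range (h : IsGramApprox k z γ κ m) {l : Filter ℕ} (hl : l ≤ atTop)
    {p q : ℕ → ℕ} {x y : ℝ} (hpn : ∀ᶠ n in l, p n ≤ n) (hqn : ∀ᶠ n in l, q n ≤ n)
    (hp : Tendsto (fun n => (p n : ℝ) / n) l (𝓝 x))
    (hq : Tendsto (fun n => (q n : ℝ) / n) l (𝓝 y)) :
    Tendsto (fun n : ℕ => (∑ i ∈ Finset.range (p n), ∑ j ∈ Finset.range (q n),
        k (z n i) (z n j)) / (n : ℝ) ^ 2) l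
      (𝓝 (∑ a, ∑ b, blockLen γ a x * blockLen γ b y * κ a b)) := by
  have hmean : Tendsto (fun n : ℕ => (∑ i ∈ Finset.range (p n), ∑ j ∈ Finset.range (q n),
      m n i j) / (n : ℝ) ^ 2) l (𝓝 (∑ a, ∑ b, blockLen γ a x * blockLen γ b y * κ a b)) := by
    have h1 : Tendsto (fun n : ℕ => ∑ a, ∑ b,
        (blockLen (fun i => (⌊(n : ℝ) * γ i⌋₊ : ℝ)) a (p n) / n)
        * (blockLen (fun i => (⌊(n : ℝ) * γ i⌋₊ : ℝ)) b (q n) / n) * κ a b) l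
        (𝓝 (∑ a, ∑ b, blockLen γ a x * blockLen γ b y * κ a b)) :=
      tendsto_finsetSum _ fun a _ => tendsto_finsetSum _ fun b _ =>
        ((tendsto_blockLen_div h.nonneg hl hp a).mul
          (tendsto_blockLen_div h.nonneg hl hq b)).mul_const _
    refine h1.congr' ?_
    filter_upwards [hpn, hqn] with n hpn hqn
    rw [sum_sum_range_eq_sum_sum_blockLen (u := fun i => ⌊(n : ℝ) * γ i⌋₊) (m := m n) (κ := κ)
      _ (by simp [h.zero]) (by simpa [h.last] using hpn) (by simpa [h.last] using hqn)
      (h.block n), Finset.sum_div]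
    · refine Finset.sum_congr rfl fun a _ => ?_
      rw [Finset.sum_div]
      refine Finset.sum_congr rfl fun b _ => ?_
      ring
    · intro i j hij
      have := h.strictMono.monotone hij
      dsimp only
      gcongr
  have hdiff : Tendsto (fun n : ℕ => (∑ i ∈ Finset.range (p n), ∑ j ∈ Finset.range (q n),
      (k (z n i) (z n j) - m n i j)) / (n : ℝ) ^ 2) l (𝓝 0) := by
    rw [Metric.tendsto_nhds]
    intro ε hε
    filter_upwards [hl (h.approx (ε / 2) (by positivity)), hpn, hqn,
      hl (eventually_gt_atTop 0)] with n hn hpn hqn h0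
    have h0' : (0 : ℝ) < (n : ℝ) ^ 2 := by positivity
    rw [Real.dist_eq, sub_zero, abs_div, abs_of_pos h0', div_lt_iff₀ h0']
    refine (hn _ hpn _ hqn).trans_lt ?_
    nlinarith
  have := hdiff.add hmean
  rw [zero_add] at this
  refine this.congr fun n => ?_
  rw [← add_div]
  congr 1
  simp [Finset.sum_sub_distrib]

theorem tendsto_sum_Ico (h : IsGramApprox k z γ κ m) {l : Filter ℕ} (hl : l ≤ atTop)
    {p p' q q' : ℕ → ℕ} {x x' y y' : ℝ} (hpp : ∀ᶠ n in l, p n ≤ p' n) (hqq : ∀ᶠ n in l, q n ≤ q' n)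
    (hpn : ∀ᶠ n in l, p' n ≤ n) (hqn : ∀ᶠ n in l, q' n ≤ n)
    (hp : Tendsto (fun n => (p n : ℝ) / n) l (𝓝 x))
    (hp' : Tendsto (fun n => (p' n : ℝ) / n) l (𝓝 x'))
    (hq : Tendsto (fun n => (q n : ℝ) / n) l (𝓝 y))
    (hq' : Tendsto (fun n => (q' n : ℝ) / n) l (𝓝 y')) :
    Tendsto (fun n : ℕ => (∑ i ∈ Finset.Ico (p n) (p' n), ∑ j ∈ Finset.Ico (q n) (q' n),
        k (z n i) (z n j)) / (n : ℝ) ^ 2) l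
      (𝓝 (∑ a, ∑ b, (blockLen γ a x' - blockLen γ a x) * (blockLen γ b y' - blockLen γ b y)
        * κ a b)) := by
  have hpn' : ∀ᶠ n in l, p n ≤ n := by
    filter_upwards [hpp, hpn] with n h1 h2 using h1.trans h2
  have hqn' : ∀ᶠ n in l, q n ≤ n := by
    filter_upwards [hqq, hqn] with n h1 h2 using h1.trans h2
  have h1 := ((h.tendsto_sum_range hl hpn hqn hp' hq').sub
    (h.tendsto_sum_range hl hpn hqn' hp' hq)).sub
    ((h.tendsto_sum_range hl hpn' hqn hp hq').sub (h.tendsto_sum_range hl hpn' hqn' hp hq))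
  convert h1.congr' ?_ using 2
  · simp only [sub_mul, mul_sub, Finset.sum_sub_distrib]
    ring
  filter_upwards [hpp, hqq] with n h1 h2
  simp only [Finset.sum_Ico_eq_sub _ h1, Finset.sum_Ico_eq_sub _ h2, Finset.sum_sub_distrib]
  ring

end IsGramApprox

theorem sum_sum_nonneg_of_posSemidef {H ι : Type*} {k : H → H → ℝ}
    (hk : (Matrix.of k).PosSemidef) (x : ι → H) (w : ι → ℝ) (S : Finset ι) :
    0 ≤ ∑ i ∈ S, ∑ j ∈ S, w i * w j * k (x i) (x j) := by
  classical
  have h := (hk.submatrix x).2 (Finsupp.indicator S fun i _ => w i)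
  rw [Finsupp.sum_of_support_subset _ (Finsupp.support_indicator_subset S _) _ (by simp)] at h
  refine h.trans_eq (Finset.sum_congr rfl fun i hi => ?_)
  rw [Finsupp.sum_of_support_subset _ (Finsupp.support_indicator_subset S _) _ (by simp)]
  refine Finset.sum_congr rfl fun j hj => ?_
  simp [hi, hj]
  ring

theorem kernel_symm {H : Type*} {k : H → H → ℝ} (hk : (Matrix.of k).PosSemidef) (x y : H) :
    k x y = k y x := by
  simpa using hk.1.apply y x

theorem blockLen_sub_of_mem {N : ℕ} {γ : Fin (N + 1) → ℝ} (hγ : Monotone γ) {a : Fin N} {x y : ℝ}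
    (hx : γ a.castSucc ≤ x) (hxy : x ≤ y) (hy : y ≤ γ a.succ) (c : Fin N) :
    blockLen γ c y - blockLen γ c x = if c = a then y - x else 0 := by
  unfold blockLen
  rcases lt_trichotomy c a with hc | rfl | hc
  · have h1 : γ c.succ ≤ γ a.castSucc := hγ (Fin.succ_le_castSucc_iff.2 hc)
    have h2 : γ c.castSucc ≤ γ c.succ := hγ (Fin.castSucc_le_succ c)
    rw [if_neg hc.ne, min_eq_right (by linarith), min_eq_right (by linarith),
      min_eq_right (by linarith), min_eq_right (by linarith)]
    ring
  · rw [if_pos rfl, min_eq_left hy, min_eq_right (hx.trans hxy), min_eq_left (hxy.trans hy),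
      min_eq_right hx]
    ring
  · have h1 : γ a.succ ≤ γ c.castSucc := hγ (Fin.succ_le_castSucc_iff.2 hc)
    have h2 : γ c.castSucc ≤ γ c.succ := hγ (Fin.castSucc_le_succ c)
    rw [if_neg hc.ne', min_eq_left (by linarith), min_eq_left (by linarith),
      min_eq_left (by linarith), min_eq_left (by linarith)]
    ring

namespace IsGramApprox

variable {H : Type*} {N : ℕ} {k : H → H → ℝ} {z : ℕ → ℕ → H} {γ : Fin (N + 1) → ℝ}
  {κ : Fin N → Fin N → ℝ} {m : ℕ → ℕ → ℕ → ℝ}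

theorem tendsto_sum_block (h : IsGramApprox k z γ κ m) (a b : Fin N) :
    Tendsto (fun n : ℕ => (∑ i ∈ Finset.Ico ⌊(n : ℝ) * γ a.castSucc⌋₊ ⌊(n : ℝ) * γ a.succ⌋₊,
      ∑ j ∈ Finset.Ico ⌊(n : ℝ) * γ b.castSucc⌋₊ ⌊(n : ℝ) * γ b.succ⌋₊,
        k (z n i) (z n j)) / (n : ℝ) ^ 2) atTop
      (𝓝 ((γ a.succ - γ a.castSucc) * (γ b.succ - γ b.castSucc) * κ a b)) := by
  have hfloor : ∀ i, Tendsto (fun n : ℕ => (⌊(n : ℝ) * γ i⌋₊ : ℝ) / n) atTop (𝓝 (γ i)) :=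
    fun i => tendsto_floor_mul_div (h.nonneg i) le_rfl
  have hle : ∀ c : Fin N, γ c.castSucc ≤ γ c.succ :=
    fun c => h.strictMono.monotone (Fin.castSucc_le_succ c)
  have hmono : ∀ c : Fin N, ∀ᶠ n : ℕ in atTop,
      ⌊(n : ℝ) * γ c.castSucc⌋₊ ≤ ⌊(n : ℝ) * γ c.succ⌋₊ :=
    fun c => Eventually.of_forall fun n => by
      have := hle c
      gcongr
  have hn : ∀ c : Fin N, ∀ᶠ n : ℕ in atTop, ⌊(n : ℝ) * γ c.succ⌋₊ ≤ n :=
    fun c => Eventually.of_forall fun n => Nat.floor_le_of_le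
      (mul_le_of_le_one_right (Nat.cast_nonneg n) (h.le_one _))
  have := h.tendsto_sum_Ico le_rfl (hmono a) (hmono b) (hn a) (hn b) (hfloor _) (hfloor _)
    (hfloor _) (hfloor _)
  simp_rw [blockLen_sub_of_mem h.strictMono.monotone le_rfl (hle a) le_rfl,
    blockLen_sub_of_mem h.strictMono.monotone le_rfl (hle b) le_rfl] at this
  simpa using this

/-- The block sums of the kernel matrices are positive semidefinite, and so is their limit. -/
theorem posSemidef (h : IsGramApprox k z γ κ m) (hk : (Matrix.of k).PosSemidef) :
    (Matrix.of fun a b => (γ a.succ - γ a.castSucc) * (γ b.succ - γ b.castSucc)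
      * κ a b).PosSemidef := by
  refine Matrix.PosSemidef.of_dotProduct_mulVec_nonneg ?_ fun c => ?_
  · ext a b
    simp only [Matrix.conjTranspose_apply, Matrix.of_apply, star_trivial]
    refine tendsto_nhds_unique (h.tendsto_sum_block b a)
      ((h.tendsto_sum_block a b).congr fun n => ?_)
    rw [Finset.sum_comm]
    simp_rw [fun i j => kernel_symm hk (z n i) (z n j)]
  · have ht : Tendsto (fun n : ℕ => ∑ a, ∑ b, c a * c b *
        ((∑ i ∈ Finset.Ico ⌊(n : ℝ) * γ a.castSucc⌋₊ ⌊(n : ℝ) * γ a.succ⌋₊,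
        ∑ j ∈ Finset.Ico ⌊(n : ℝ) * γ b.castSucc⌋₊ ⌊(n : ℝ) * γ b.succ⌋₊,
        k (z n i) (z n j)) / (n : ℝ) ^ 2)) atTop
        (𝓝 (∑ a, ∑ b, c a * c b *
          ((γ a.succ - γ a.castSucc) * (γ b.succ - γ b.castSucc) * κ a b))) :=
      tendsto_finsetSum _ fun a _ => tendsto_finsetSum _ fun b _ =>
        (h.tendsto_sum_block a b).const_mul _
    have hq : star c ⬝ᵥ (Matrix.of fun a b => (γ a.succ - γ a.castSucc)
        * (γ b.succ - γ b.castSucc) * κ a b).mulVec c = ∑ a, ∑ b, c a * c b *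
          ((γ a.succ - γ a.castSucc) * (γ b.succ - γ b.castSucc) * κ a b) := by
      simp only [dotProduct, Matrix.mulVec, Matrix.of_apply, Finset.mul_sum, Pi.star_apply,
        star_trivial]
      exact Finset.sum_congr rfl fun a _ => Finset.sum_congr rfl fun b _ => by ring
    rw [hq]
    refine ge_of_tendsto' ht fun n => ?_
    have hpos := sum_sum_nonneg_of_posSemidef hk (fun s : (_ : Fin N) × ℕ => z n s.2)
      (fun s => c s.1) (Finset.univ.sigma fun a : Fin N =>
        Finset.Ico ⌊(n : ℝ) * γ a.castSucc⌋₊ ⌊(n : ℝ) * γ a.succ⌋₊)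
    simp only [Finset.sum_sigma] at hpos
    have := div_nonneg hpos (sq_nonneg (n : ℝ))
    refine this.trans_eq ?_
    rw [Finset.sum_div]
    refine Finset.sum_congr rfl fun a _ => ?_
    rw [Finset.sum_comm, Finset.sum_div]
    refine Finset.sum_congr rfl fun b _ => ?_
    simp_rw [← Finset.mul_sum]
    ring

/-- The limiting matrix `κ` is the Gram matrix of finitely many vectors. -/
theorem exists_inner_eq (h : IsGramApprox k z γ κ m) (hk : (Matrix.of k).PosSemidef) :
    ∃ (d : ℕ) (v : Fin N → EuclideanSpace ℝ (Fin d)), ∀ a b, inner ℝ (v a) (v b) = κ a b := by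
  obtain ⟨d, u, hu⟩ := Matrix.posSemidef_iff_eq_sum_vecMulVec.1 (h.posSemidef hk)
  refine ⟨d, fun a => (γ a.succ - γ a.castSucc)⁻¹ • WithLp.toLp 2 fun i => u i a, fun a b => ?_⟩
  have hab := congrFun (congrFun hu a) b
  have hpos : ∀ c : Fin N, γ c.succ - γ c.castSucc ≠ 0 :=
    fun c => (sub_pos.2 (h.strictMono (Fin.castSucc_lt_succ))).ne'
  have ha := hpos a
  have hb := hpos b
  rw [inner_smul_left, inner_smul_right, EuclideanSpace.inner_toLp_toLp]
  simp only [Matrix.of_apply, Matrix.sum_apply, Matrix.vecMulVec_apply,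
    star_trivial] at hab
  have : (fun i => u i b) ⬝ᵥ star (fun i => u i a) = ∑ i, u i a * u i b :=
    Finset.sum_congr rfl fun i _ => by simp [mul_comm]
  rw [this, ← hab]
  simp only [map_inv₀, conj_trivial]
  field_simp

end IsGramApprox

/-- The piecewise linear path through the origin with velocity `v a` on the `a`-th interval of the
grid `γ`. -/
noncomputable def blockPath {E : Type*} [NormedAddCommGroup E] [InnerProductSpace ℝ E] {N : ℕ}
    (γ : Fin (N + 1) → ℝ) (v : Fin N → E) (x : ℝ) : E :=
  ∑ a, blockLen γ a x • v a

theorem blockPath_sub_of_mem {E : Type*} [NormedAddCommGroup E] [InnerProductSpace ℝ E] {N : ℕ}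
    {γ : Fin (N + 1) → ℝ} (hγ : Monotone γ) (v : Fin N → E) {a : Fin N} {x y : ℝ}
    (hx : γ a.castSucc ≤ x) (hxy : x ≤ y) (hy : y ≤ γ a.succ) :
    blockPath γ v y - blockPath γ v x = (y - x) • v a := by
  simp_rw [blockPath, ← Finset.sum_sub_distrib, ← sub_smul, blockLen_sub_of_mem hγ hx hxy hy,
    ite_smul, zero_smul, Finset.sum_ite_eq' Finset.univ a, Finset.mem_univ, if_true]

theorem IsGramApprox.tendsto_sum_Ico_inner {H E : Type*} [NormedAddCommGroup E]
    [InnerProductSpace ℝ E] {N : ℕ} {k : H → H → ℝ} {z : ℕ → ℕ → H} {γ : Fin (N + 1) → ℝ}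
    {κ : Fin N → Fin N → ℝ} {m : ℕ → ℕ → ℕ → ℝ} (h : IsGramApprox k z γ κ m)
    {v : Fin N → E} (hv : ∀ a b, inner ℝ (v a) (v b) = κ a b)
    {l : Filter ℕ} (hl : l ≤ atTop)
    {p p' q q' : ℕ → ℕ} {x x' y y' : ℝ} (hpp : ∀ᶠ n in l, p n ≤ p' n) (hqq : ∀ᶠ n in l, q n ≤ q' n)
    (hpn : ∀ᶠ n in l, p' n ≤ n) (hqn : ∀ᶠ n in l, q' n ≤ n)
    (hp : Tendsto (fun n => (p n : ℝ) / n) l (𝓝 x))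
    (hp' : Tendsto (fun n => (p' n : ℝ) / n) l (𝓝 x'))
    (hq : Tendsto (fun n => (q n : ℝ) / n) l (𝓝 y))
    (hq' : Tendsto (fun n => (q' n : ℝ) / n) l (𝓝 y')) :
    Tendsto (fun n : ℕ => (∑ i ∈ Finset.Ico (p n) (p' n), ∑ j ∈ Finset.Ico (q n) (q' n),
        k (z n i) (z n j)) / (n : ℝ) ^ 2) l
      (𝓝 (inner ℝ (blockPath γ v x' - blockPath γ v x) (blockPath γ v y' - blockPath γ v y))) := by
  convert h.tendsto_sum_Ico hl hpp hqq hpn hqn hp hp' hq hq' using 2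
  simp_rw [blockPath, ← Finset.sum_sub_distrib, ← sub_smul, sum_inner, inner_sum,
    real_inner_smul_left, real_inner_smul_right, hv, mul_assoc]

/-! ### The limit of the split criterion -/

/-- Limit of `splitRho` on a segment with limiting end points `x < y` and limiting split point `θ`,
when the partial sums of the feature vectors follow the path `W`. At `θ = x` and at `θ = y` the
denominator vanishes and the value is `0`, which is also the limit there. -/
noncomputable def splitLimit {E : Type*} [NormedAddCommGroup E] [InnerProductSpace ℝ E]
    (W : ℝ → E) (x y θ : ℝ) : ℝ :=
  ‖(y - θ) • (W θ - W x) - (θ - x) • (W y - W θ)‖ ^ 2 / ((y - x) ^ 2 * ((θ - x) * (y - θ)))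

theorem abs_mul_sum_sum_le {H : Type*} {k : H → H → ℝ} {B : ℝ} (hB : 0 ≤ B)
    (hkB : ∀ x y, |k x y| ≤ B) (z : ℕ → H) (S T : Finset ℕ) :
    |1 / ((S.card : ℝ) * T.card) * ∑ i ∈ S, ∑ j ∈ T, k (z i) (z j)| ≤ B := by
  have h : |∑ i ∈ S, ∑ j ∈ T, k (z i) (z j)| ≤ (S.card * T.card) * B := by
    calc |∑ i ∈ S, ∑ j ∈ T, k (z i) (z j)| ≤ ∑ i ∈ S, |∑ j ∈ T, k (z i) (z j)| :=
          Finset.abs_sum_le_sum_abs _ _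
      _ ≤ ∑ i ∈ S, ∑ j ∈ T, |k (z i) (z j)| :=
          Finset.sum_le_sum fun i _ => Finset.abs_sum_le_sum_abs _ _
      _ ≤ ∑ i ∈ S, ∑ j ∈ T, B :=
          Finset.sum_le_sum fun i _ => Finset.sum_le_sum fun j _ => hkB _ _
      _ = _ := by simp [mul_assoc]
  rcases (by positivity : (0 : ℝ) ≤ S.card * T.card).eq_or_lt with h0 | h0
  · simp [← h0, hB]
  · rw [abs_mul, abs_of_pos (by positivity), one_div, inv_mul_le_iff₀ h0]
    exact h

theorem abs_empMmdSq_le {H : Type*} {k : H → H → ℝ} {B : ℝ} (hB : 0 ≤ B)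
    (hkB : ∀ x y, |k x y| ≤ B) (z : ℕ → H) (S T : Finset ℕ) :
    |empMmdSq k z S T| ≤ 4 * B := by
  have h1 := abs_le.1 (abs_mul_sum_sum_le hB hkB z S S)
  have h2 := abs_le.1 (abs_mul_sum_sum_le hB hkB z T T)
  have h3 := abs_le.1 (abs_mul_sum_sum_le hB hkB z S T)
  have h4 : empMmdSq k z S T = 1 / ((S.card : ℝ) * S.card) * (∑ i ∈ S, ∑ j ∈ S, k (z i) (z j))
      + 1 / ((T.card : ℝ) * T.card) * (∑ i ∈ T, ∑ j ∈ T, k (z i) (z j))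
      - 2 * (1 / ((S.card : ℝ) * T.card) * (∑ i ∈ S, ∑ j ∈ T, k (z i) (z j))) := by
    unfold empMmdSq
    ring
  rw [h4, abs_le]
  constructor <;> linarith [h1.1, h1.2, h2.1, h2.2, h3.1, h3.2]

/-- With `p = θ - x`, `q = y - θ` and path increments `P`, `R`, this is
`p q / (p + q) ^ 2 * ‖P / p - R / q‖ ^ 2 = ‖q P - p R‖ ^ 2 / ((p + q) ^ 2 p q)`. -/
theorem mul_mmd_eq_splitLimit {E : Type*} [NormedAddCommGroup E] [InnerProductSpace ℝ E]
    (W : ℝ → E) {x y θ : ℝ} (hx : x < θ) (hy : θ < y) :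
    ((θ - x) * (y - θ) / ((θ - x) + (y - θ)) ^ 2) *
      (1 / (θ - x) ^ 2 * inner ℝ (W θ - W x) (W θ - W x)
        + 1 / (y - θ) ^ 2 * inner ℝ (W y - W θ) (W y - W θ)
        - 2 / ((θ - x) * (y - θ)) * inner ℝ (W θ - W x) (W y - W θ))
      = splitLimit W x y θ := by
  have hp : θ - x ≠ 0 := (sub_pos.2 hx).ne'
  have hq : y - θ ≠ 0 := (sub_pos.2 hy).ne'
  have hr : y - x ≠ 0 := (sub_pos.2 (hx.trans hy)).ne'
  rw [splitLimit, norm_sub_sq_real, norm_smul, norm_smul, mul_pow, mul_pow, Real.norm_eq_abs,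
    Real.norm_eq_abs, sq_abs, sq_abs, real_inner_smul_left, real_inner_smul_right,
    real_inner_self_eq_norm_sq, real_inner_self_eq_norm_sq,
    show θ - x + (y - θ) = y - x by ring]
  field_simp
  ring

/-- Convergence of the split criterion, up to and including the ends of the segment. -/
theorem IsGramApprox.tendsto_splitRho {H E : Type*} [NormedAddCommGroup E]
    [InnerProductSpace ℝ E] {N : ℕ} {k : H → H → ℝ} {z : ℕ → ℕ → H} {γ : Fin (N + 1) → ℝ}
    {κ : Fin N → Fin N → ℝ} {m : ℕ → ℕ → ℕ → ℝ} (h : IsGramApprox k z γ κ m)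
    {v : Fin N → E} (hv : ∀ a b, inner ℝ (v a) (v b) = κ a b)
    {B : ℝ} (hkB : ∀ x y, |k x y| ≤ B) {l : Filter ℕ} [l.NeBot] (hl : l ≤ atTop)
    {a b t : ℕ → ℕ} {x y s : ℝ} (htb : ∀ᶠ n in l, a n + t n ≤ b n) (hbn : ∀ᶠ n in l, b n ≤ n)
    (ha : Tendsto (fun n => (a n : ℝ) / n) l (𝓝 x))
    (hb : Tendsto (fun n => (b n : ℝ) / n) l (𝓝 y))
    (ht : Tendsto (fun n => (t n : ℝ) / n) l (𝓝 s)) (hxy : x < y) :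
    Tendsto (fun n => splitRho k (z n) (a n) (b n) (t n)) l
      (𝓝 (splitLimit (blockPath γ v) x y (x + s))) := by
  have hθ : Tendsto (fun n => ((a n + t n : ℕ) : ℝ) / n) l (𝓝 (x + s)) :=
    (ha.add ht).congr fun n => by push_cast; ring
  have hr : Tendsto (fun n => ((b n - (a n + t n) : ℕ) : ℝ) / n) l (𝓝 (y - (x + s))) := by
    refine (hb.sub hθ).congr' ?_
    filter_upwards [htb] with n hn
    rw [Nat.cast_sub hn]
    ring
  have hs0 : 0 ≤ s := ge_of_tendsto' ht fun n => by positivity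
  have hr0 : 0 ≤ y - (x + s) := ge_of_tendsto' hr fun n => by positivity
  have hpos : ∀ᶠ n : ℕ in l, 0 < n := hl (eventually_gt_atTop 0)
  have hcard : ∀ n, (Finset.Ico (a n) (a n + t n)).card = t n := fun n => by simp
  have hcard' : ∀ n, (Finset.Ico (a n + t n) (b n)).card = b n - (a n + t n) := fun n => by simp
  have hsr : s + (y - (x + s)) ≠ 0 := by
    have := sub_pos.2 hxy
    intro h0
    linarith
  have hfac : Tendsto (fun n => (t n : ℝ) * (b n - (a n + t n) : ℕ)
      / ((t n : ℝ) + (b n - (a n + t n) : ℕ)) ^ 2) l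
      (𝓝 (s * (y - (x + s)) / (s + (y - (x + s))) ^ 2)) := by
    refine ((ht.mul hr).div ((ht.add hr).pow 2) (pow_ne_zero 2 hsr)).congr' ?_
    filter_upwards [hpos] with n hn
    have hn' : (n : ℝ) ≠ 0 := by positivity
    simp only [Pi.div_apply]
    rw [← add_div, div_pow, div_mul_div_comm, ← sq, div_div_div_cancel_right₀ (pow_ne_zero 2 hn')]
  by_cases hint : 0 < s ∧ 0 < y - (x + s)
  · obtain ⟨hs, hr1⟩ := hint
    have hat : ∀ᶠ n in l, a n ≤ a n + t n := Eventually.of_forall fun n => by omega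
    have hatn : ∀ᶠ n in l, a n + t n ≤ n := by
      filter_upwards [htb, hbn] with n h1 h2 using h1.trans h2
    have hPP := h.tendsto_sum_Ico_inner hv hl hat hat hatn hatn ha hθ ha hθ
    have hRR := h.tendsto_sum_Ico_inner hv hl htb htb hbn hbn hθ hb hθ hb
    have hPR := h.tendsto_sum_Ico_inner hv hl hat htb hatn hbn ha hθ hθ hb
    have hone : Tendsto (fun _ : ℕ => (1 : ℝ)) l (𝓝 1) := tendsto_const_nhds
    have htwo : Tendsto (fun _ : ℕ => (2 : ℝ)) l (𝓝 2) := tendsto_const_nhds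
    have hlim := hfac.mul (((((hone.div (ht.pow 2) (pow_ne_zero 2 hs.ne')).mul hPP).add
      ((hone.div (hr.pow 2) (pow_ne_zero 2 hr1.ne')).mul hRR)).sub
      ((htwo.div (ht.mul hr) (mul_pos hs hr1).ne').mul hPR)))
    have heq := mul_mmd_eq_splitLimit (blockPath γ v) (x := x) (y := y) (θ := x + s)
      (by linarith) (by linarith)
    rw [add_sub_cancel_left] at heq
    rw [heq] at hlim
    refine hlim.congr' ?_
    filter_upwards [hpos] with n hn
    have hn' : (n : ℝ) ≠ 0 := by positivity
    simp only [splitRho, rho, empMmdSq, hcard, hcard', Pi.div_apply]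
    congr 1
    field_simp
  -- At an end of the segment the weight of `ρ` vanishes in the limit, and `d` is bounded by `4 * B`.
  · have hprod : s * (y - (x + s)) = 0 := by
      rcases hs0.eq_or_lt with h0 | h0
      · simp [← h0]
      · rcases hr0.eq_or_lt with h1 | h1
        · simp [← h1]
        · exact absurd ⟨h0, h1⟩ hint
    have hlim0 : splitLimit (blockPath γ v) x y (x + s) = 0 := by
      rw [splitLimit, add_sub_cancel_left, hprod, mul_zero, div_zero]
    have hB : 0 ≤ B := by
      obtain ⟨n, hn⟩ := hpos.exists
      exact (abs_nonneg _).trans (hkB (z n 0) (z n 0))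
    rw [hprod, zero_div] at hfac
    rw [hlim0]
    have hbd : Tendsto (fun n => |(t n : ℝ) * (b n - (a n + t n) : ℕ)
      / ((t n : ℝ) + (b n - (a n + t n) : ℕ)) ^ 2| * (4 * B)) l (𝓝 0) := by
      simpa using hfac.abs.mul_const (4 * B)
    refine squeeze_zero_norm (fun n => ?_) hbd
    rw [splitRho, rho, hcard, hcard', Real.norm_eq_abs, abs_mul]
    exact mul_le_mul_of_nonneg_left (abs_empMmdSq_le hB hkB _ _ _) (abs_nonneg _)

/-! ### Maximisers of the limiting criterion -/

theorem splitLimit_numerator_eq {E : Type*} [NormedAddCommGroup E] [InnerProductSpace ℝ E]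
    (W : ℝ → E) (x y θ : ℝ) :
    (y - θ) • (W θ - W x) - (θ - x) • (W y - W θ)
      = (y - x) • (W θ - W x) - (θ - x) • (W y - W x) := by
  module

/-- A maximiser of the criterion with positive value cannot lie where the path is locally affine:
there the numerator is a convex and the denominator a strictly concave quadratic function. -/
theorem exists_splitLimit_lt_of_affine {E : Type*} [NormedAddCommGroup E] [InnerProductSpace ℝ E]
    {W : ℝ → E} {x y θ : ℝ} (hx : x < θ) (hy : θ < y) {w : E}
    (hW : ∀ᶠ h in 𝓝 (0 : ℝ), W (θ + h) = W θ + h • w) (hpos : 0 < splitLimit W x y θ) :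
    ∃ s ∈ Set.Ioo x y, splitLimit W x y θ < splitLimit W x y s := by
  by_contra! hmax
  set M := splitLimit W x y θ with hM
  have hWneg : ∀ᶠ h in 𝓝 (0 : ℝ), W (θ + -h) = W θ + (-h) • w := by
    have : Tendsto (fun h : ℝ => -h) (𝓝 0) (𝓝 0) := by simpa using (continuous_neg.tendsto (0 : ℝ))
    exact this.eventually hW
  have hlt1 : ∀ᶠ h in 𝓝 (0 : ℝ), h < θ - x := eventually_lt_nhds (sub_pos.2 hx)
  have hlt2 : ∀ᶠ h in 𝓝 (0 : ℝ), h < y - θ := eventually_lt_nhds (sub_pos.2 hy)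
  obtain ⟨h, ⟨⟨⟨hW1, hW2⟩, hx1⟩, hy1⟩, hh⟩ :=
    (((((hW.and hWneg).and hlt1).and hlt2).filter_mono
      (nhdsWithin_le_nhds (s := Set.Ioi 0))).and self_mem_nhdsWithin).exists
  replace hh : 0 < h := hh
  set u : E := (y - x) • (W θ - W x) - (θ - x) • (W y - W x) with hu
  set e : E := (y - x) • w - (W y - W x) with he
  have hval : ∀ s ∈ Set.Ioo x y, splitLimit W x y s * ((y - x) ^ 2 * ((s - x) * (y - s)))
      = ‖(y - x) • (W s - W x) - (s - x) • (W y - W x)‖ ^ 2 := by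
    intro s hs
    have h1 := sub_pos.2 hs.1
    have h2 := sub_pos.2 hs.2
    have h3 := sub_pos.2 (hx.trans hy)
    rw [splitLimit, splitLimit_numerator_eq, div_mul_cancel₀ _ (by positivity)]
  have hθ := hval θ ⟨hx, hy⟩
  have hp : θ + h ∈ Set.Ioo x y := ⟨by linarith, by linarith⟩
  have hm : θ + -h ∈ Set.Ioo x y := ⟨by linarith, by linarith⟩
  have hle : ∀ s ∈ Set.Ioo x y, ‖(y - x) • (W s - W x) - (s - x) • (W y - W x)‖ ^ 2
      ≤ M * ((y - x) ^ 2 * ((s - x) * (y - s))) := by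
    intro s hs
    rw [← hval s hs]
    have h1 := sub_pos.2 hs.1
    have h2 := sub_pos.2 hs.2
    exact mul_le_mul_of_nonneg_right (hmax s hs) (by positivity)
  have h1 := hle _ hp
  have h2 := hle _ hm
  have e1 : (y - x) • (W (θ + h) - W x) - (θ + h - x) • (W y - W x) = u + h • e := by
    rw [hW1, hu, he]
    module
  have e2 : (y - x) • (W (θ + -h) - W x) - (θ + -h - x) • (W y - W x) = u - h • e := by
    rw [hW2, hu, he]
    module
  -- The parallelogram law turns the two bounds into `2 ‖u‖ ^ 2 + 2 ‖h • e‖ ^ 2 ≤ 2 ‖u‖ ^ 2 - c h ^ 2`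
  -- with `c = 2 * M * (y - x) ^ 2 > 0`.
  have hpar := parallelogram_law_with_norm ℝ u (h • e)
  rw [e1] at h1
  rw [e2] at h2
  rw [← hM, ← hu] at hθ
  have hyx := sub_pos.2 (hx.trans hy)
  have hfin : 0 < M * (y - x) ^ 2 * h ^ 2 := by positivity
  nlinarith [sq_nonneg ‖h • e‖]

/-- The criterion is positive somewhere on a segment that contains a kink of the path. -/
theorem exists_splitLimit_pos_of_kink {E : Type*} [NormedAddCommGroup E] [InnerProductSpace ℝ E]
    {W : ℝ → E} {x y β : ℝ} (hx : x < β) (hy : β < y) {w w' : E} (hw : w ≠ w')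
    (hright : ∀ᶠ h in 𝓝[>] (0 : ℝ), W (β + h) = W β + h • w')
    (hleft : ∀ᶠ h in 𝓝[>] (0 : ℝ), W (β - h) = W β - h • w) :
    ∃ s ∈ Set.Ioo x y, 0 < splitLimit W x y s := by
  by_contra! hmax
  have hyx := sub_pos.2 (hx.trans hy)
  have hzero : ∀ s ∈ Set.Ioo x y, (y - x) • (W s - W x) - (s - x) • (W y - W x) = 0 := by
    intro s hs
    have h1 := sub_pos.2 hs.1
    have h2 := sub_pos.2 hs.2
    by_contra hne
    refine absurd (hmax s hs) (not_le.2 ?_)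
    rw [splitLimit, splitLimit_numerator_eq]
    have := norm_pos_iff.2 hne
    positivity
  have hlt1 : ∀ᶠ h in 𝓝[>] (0 : ℝ), h < β - x :=
    (eventually_lt_nhds (sub_pos.2 hx)).filter_mono nhdsWithin_le_nhds
  have hlt2 : ∀ᶠ h in 𝓝[>] (0 : ℝ), h < y - β :=
    (eventually_lt_nhds (sub_pos.2 hy)).filter_mono nhdsWithin_le_nhds
  obtain ⟨h, ⟨⟨⟨hW1, hW2⟩, hx1⟩, hy1⟩, hh⟩ :=
    ((((hright.and hleft).and hlt1).and hlt2).and self_mem_nhdsWithin).exists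
  replace hh : 0 < h := hh
  have h0 := hzero β ⟨hx, hy⟩
  have h1 := hzero (β + h) ⟨by linarith, by linarith⟩
  have h2 := hzero (β - h) ⟨by linarith, by linarith⟩
  rw [hW1] at h1
  rw [hW2] at h2
  have h3 : (h * (y - x)) • (w' - w) = 0 := by
    calc (h * (y - x)) • (w' - w)
        = ((y - x) • (W β + h • w' - W x) - (β + h - x) • (W y - W x))
          + ((y - x) • (W β - h • w - W x) - (β - h - x) • (W y - W x))
          - (2 : ℝ) • ((y - x) • (W β - W x) - (β - x) • (W y - W x)) := by module
      _ = 0 := by rw [h1, h2, h0]; simp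
  rcases smul_eq_zero.1 h3 with h4 | h4
  · exact absurd h4 (by positivity)
  · exact hw (sub_eq_zero.1 h4).symm

/-! ### Location of a point in a grid -/

theorem exists_castSucc_le_lt_succ {N : ℕ} (f : Fin (N + 1) → ℝ) {θ : ℝ} (h0 : f 0 ≤ θ)
    (h1 : θ < f (Fin.last N)) : ∃ a : Fin N, f a.castSucc ≤ θ ∧ θ < f a.succ := by
  by_contra! hcon
  have : ∀ i, f i ≤ θ := fun i => Fin.induction h0 (fun a ha => hcon a ha) i
  exact absurd h1 (not_lt.2 (this _))

theorem exists_mem_Ioo_or_eq_interior {M : ℕ} (f : Fin (M + 2) → ℝ) {θ : ℝ} (h0 : f 0 < θ)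
    (h1 : θ < f (Fin.last (M + 1))) :
    (∃ a : Fin (M + 1), f a.castSucc < θ ∧ θ < f a.succ) ∨
      ∃ i : Fin M, θ = f i.succ.castSucc := by
  obtain ⟨a, ha, ha'⟩ := exists_castSucc_le_lt_succ f h0.le h1
  rcases ha.eq_or_lt with h | h
  · right
    have hne : a ≠ 0 := by
      rintro rfl
      exact h0.ne h
    exact ⟨a.pred hne, by rw [Fin.succ_pred, h]⟩
  · exact Or.inl ⟨a, h, ha'⟩

theorem blockPath_affine_of_mem {E : Type*} [NormedAddCommGroup E] [InnerProductSpace ℝ E] {N : ℕ}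
    {γ : Fin (N + 1) → ℝ} (hγ : Monotone γ) (v : Fin N → E) {a : Fin N} {θ : ℝ}
    (h1 : γ a.castSucc < θ) (h2 : θ < γ a.succ) :
    ∀ᶠ h in 𝓝 (0 : ℝ), blockPath γ v (θ + h) = blockPath γ v θ + h • v a := by
  have hlt1 : ∀ᶠ h in 𝓝 (0 : ℝ), γ a.castSucc - θ < h := eventually_gt_nhds (by linarith)
  have hlt2 : ∀ᶠ h in 𝓝 (0 : ℝ), h < γ a.succ - θ := eventually_lt_nhds (by linarith)
  filter_upwards [hlt1, hlt2] with h h3 h4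
  rcases le_total 0 h with hh | hh
  · have := blockPath_sub_of_mem hγ v (a := a) (x := θ) (y := θ + h) h1.le (by linarith)
      (by linarith)
    rw [add_sub_cancel_left] at this
    rw [← this]
    abel
  · have := blockPath_sub_of_mem hγ v (a := a) (x := θ + h) (y := θ) (by linarith) (by linarith)
      h2.le
    rw [show θ - (θ + h) = -h by ring, neg_smul] at this
    rw [← neg_neg (h • v a), ← this]
    abel

/-- A maximiser of the limiting criterion with positive value is an interior grid point. -/
theorem exists_eq_of_isMax_splitLimit {E : Type*} [NormedAddCommGroup E] [InnerProductSpace ℝ E]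
    {M : ℕ} {γ : Fin (M + 2) → ℝ} (hγ : Monotone γ) (v : Fin (M + 1) → E) {x y θ : ℝ}
    (hx0 : γ 0 ≤ x) (hy1 : y ≤ γ (Fin.last (M + 1))) (hx : x < θ) (hy : θ < y)
    (hpos : 0 < splitLimit (blockPath γ v) x y θ)
    (hmax : ∀ s ∈ Set.Ioo x y,
      splitLimit (blockPath γ v) x y s ≤ splitLimit (blockPath γ v) x y θ) :
    ∃ i : Fin M, θ = γ i.succ.castSucc := by
  rcases exists_mem_Ioo_or_eq_interior γ (hx0.trans_lt hx) (hy.trans_le hy1) with ⟨a, h1, h2⟩ | h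
  · obtain ⟨s, hs, hlt⟩ := exists_splitLimit_lt_of_affine hx hy
      (blockPath_affine_of_mem hγ v h1 h2) hpos
    exact absurd hlt (not_lt.2 (hmax s hs))
  · exact h

theorem exists_splitLimit_pos {E : Type*} [NormedAddCommGroup E] [InnerProductSpace ℝ E]
    {M : ℕ} {γ : Fin (M + 2) → ℝ} (hγ : StrictMono γ) {v : Fin (M + 1) → E} {i : Fin M}
    (hv : v i.castSucc ≠ v i.succ) {x y : ℝ}
    (hx : x < γ i.succ.castSucc) (hy : γ i.succ.castSucc < y) :
    ∃ s ∈ Set.Ioo x y, 0 < splitLimit (blockPath γ v) x y s := by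
  refine exists_splitLimit_pos_of_kink hx hy hv ?_ ?_
  · have hlt : ∀ᶠ h in 𝓝[>] (0 : ℝ), h < γ i.succ.succ - γ i.succ.castSucc :=
      (eventually_lt_nhds (sub_pos.2 (hγ (Fin.castSucc_lt_succ)))).filter_mono nhdsWithin_le_nhds
    filter_upwards [hlt, self_mem_nhdsWithin] with h h1 h2
    have h2' : 0 < h := h2
    have := blockPath_sub_of_mem hγ.monotone v (a := i.succ) (x := γ i.succ.castSucc)
      (y := γ i.succ.castSucc + h) le_rfl (by linarith) (by linarith)
    rw [add_sub_cancel_left] at this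
    rw [← this]
    abel
  · have hlt : ∀ᶠ h in 𝓝[>] (0 : ℝ), h < γ i.castSucc.succ - γ i.castSucc.castSucc :=
      (eventually_lt_nhds (sub_pos.2 (hγ (Fin.castSucc_lt_succ)))).filter_mono nhdsWithin_le_nhds
    filter_upwards [hlt, self_mem_nhdsWithin] with h h1 h2
    have h2' : 0 < h := h2
    rw [Fin.succ_castSucc] at h1
    have := blockPath_sub_of_mem hγ.monotone v (a := i.castSucc) (x := γ i.succ.castSucc - h)
      (y := γ i.succ.castSucc) (by linarith) (by linarith) (by rw [Fin.succ_castSucc])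
    rw [sub_sub_cancel] at this
    rw [← this]
    abel

/-! ### Refining a list of boundaries -/

/-- A relation between neighbours in a list survives the insertion of `w` between `f j` and
`f (j + 1)` if `w` is related to both; it is used for `≤`, `<` and `a + L ≤ b`. -/
theorem insertNth_rel {α : Type*} {N : ℕ} {r : α → α → Prop} {f : Fin (N + 1) → α}
    (hf : ∀ i : Fin N, r (f i.castSucc) (f i.succ)) {j : Fin N} {w : α}
    (h1 : r (f j.castSucc) w) (h2 : r w (f j.succ)) (i : Fin (N + 1)) :
    r (Fin.insertNth (α := fun _ => α) j.succ.castSucc w f i.castSucc)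
      (Fin.insertNth (α := fun _ => α) j.succ.castSucc w f i.succ) := by
  have below : ∀ q : Fin (N + 1), q.val ≤ j.val →
      Fin.insertNth (α := fun _ => α) j.succ.castSucc w f q.castSucc = f q := by
    intro q hq
    have : q.castSucc = j.succ.castSucc.succAbove q := by
      rw [Fin.succAbove_of_castSucc_lt]
      simp only [Fin.lt_def, Fin.val_castSucc, Fin.val_succ]
      omega
    rw [this, Fin.insertNth_apply_succAbove]
  have above : ∀ q : Fin (N + 1), j.val + 1 ≤ q.val →
      Fin.insertNth (α := fun _ => α) j.succ.castSucc w f q.succ = f q := by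
    intro q hq
    have : q.succ = j.succ.castSucc.succAbove q := by
      rw [Fin.succAbove_of_le_castSucc]
      simp only [Fin.le_def, Fin.val_castSucc, Fin.val_succ]
      omega
    rw [this, Fin.insertNth_apply_succAbove]
  rcases lt_trichotomy i.val j.val with h | h | h
  · have e : i.succ = (⟨i.val + 1, by omega⟩ : Fin (N + 1)).castSucc := rfl
    rw [below i h.le, e, below _ (by simpa using h)]
    exact hf ⟨i.val, by omega⟩
  · have e : i = j.castSucc := Fin.ext h
    have e' : i.succ = j.succ.castSucc := by rw [e, Fin.succ_castSucc]
    rw [below i h.le, e', Fin.insertNth_apply_same, e]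
    exact h1
  · rw [above i h]
    rcases (show j.val + 1 = i.val ∨ j.val + 2 ≤ i.val by omega) with h' | h'
    · have e : i = j.succ := Fin.ext (by simpa using h'.symm)
      rw [e, Fin.insertNth_apply_same]
      exact h2
    · have e : i.castSucc = (⟨i.val - 1, by omega⟩ : Fin (N + 1)).succ :=
        Fin.ext (by simp; omega)
      rw [e, above _ (by simp; omega)]
      have := hf ⟨i.val - 1, by omega⟩
      convert this using 2
      all_goals exact Fin.ext (by simp <;> omega)

theorem insertNth_castSucc_succ_zero {α : Type*} {N : ℕ} (f : Fin (N + 1) → α) (j : Fin N)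
    (w : α) : Fin.insertNth (α := fun _ => α) j.succ.castSucc w f 0 = f 0 := by
  have : (0 : Fin (N + 2)) = j.succ.castSucc.succAbove 0 :=
    (Fin.succAbove_ne_zero_zero (Fin.castSucc_ne_zero_iff.2 (Fin.succ_ne_zero j))).symm
  conv_lhs => rw [this]
  rw [Fin.insertNth_apply_succAbove]

theorem insertNth_castSucc_succ_last {α : Type*} {N : ℕ} (f : Fin (N + 1) → α) (j : Fin N)
    (w : α) : Fin.insertNth (α := fun _ => α) j.succ.castSucc w f (Fin.last (N + 1))
      = f (Fin.last N) := by
  have : Fin.last (N + 1) = j.succ.castSucc.succAbove (Fin.last N) :=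
    (Fin.succAbove_ne_last_last (Fin.castSucc_lt_last _).ne).symm
  conv_lhs => rw [this]
  rw [Fin.insertNth_apply_succAbove]

theorem succAbove_castSucc_succ_ne_zero_iff {N : ℕ} (j : Fin N) (q : Fin (N + 1)) :
    j.succ.castSucc.succAbove q ≠ 0 ↔ q ≠ 0 := by
  rw [not_iff_not]
  have : (0 : Fin (N + 2)) = j.succ.castSucc.succAbove 0 :=
    (Fin.succAbove_ne_zero_zero (Fin.castSucc_ne_zero_iff.2 (Fin.succ_ne_zero j))).symm
  conv_lhs => rw [this]
  exact Fin.succAbove_right_inj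

theorem succAbove_castSucc_succ_ne_last_iff {N : ℕ} (j : Fin N) (q : Fin (N + 1)) :
    j.succ.castSucc.succAbove q ≠ Fin.last (N + 1) ↔ q ≠ Fin.last N := by
  rw [not_iff_not]
  have : Fin.last (N + 1) = j.succ.castSucc.succAbove (Fin.last N) :=
    (Fin.succAbove_ne_last_last (Fin.castSucc_lt_last _).ne).symm
  conv_lhs => rw [this]
  exact Fin.succAbove_right_inj

theorem exists_eq_succ_castSucc {M : ℕ} {l : Fin (M + 2)} (h0 : l ≠ 0)
    (h1 : l ≠ Fin.last (M + 1)) : ∃ i : Fin M, l = i.succ.castSucc := by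
  obtain ⟨q, rfl⟩ := Fin.exists_castSucc_eq.2 h1
  obtain ⟨i, rfl⟩ := Fin.exists_succ_eq.2 (Fin.castSucc_ne_zero_iff.1 h0)
  exact ⟨i, rfl⟩

theorem IsCandidate.le {H : Type*} {δ : ℕ → ℝ} (hδ : ∀ n, 1 ≤ n → δ n ∈ Set.Ioo (0 : ℝ) 1)
    {k : H → H → ℝ} {z : ℕ → H} {a b t : ℕ} (h : IsCandidate δ k z a b t) : t ≤ b - a := by
  have h1 := (Finset.mem_Icc.1 h.1).2
  rcases Nat.eq_zero_or_pos (b - a) with h0 | h0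
  · simpa [h0] using h1
  · refine h1.trans (Nat.floor_le_of_le ?_)
    have := (hδ _ h0).1
    exact mul_le_of_le_one_right (Nat.cast_nonneg _) (by linarith)

theorem IsStage.monotone {H : Type*} {δ : ℕ → ℝ} (hδ : ∀ n, 1 ≤ n → δ n ∈ Set.Ioo (0 : ℝ) 1)
    {k : H → H → ℝ} {z : ℕ → H} {n i : ℕ} {c : Fin (i + 2) → ℕ} (h : IsStage δ k z n i c) :
    Monotone c ∧ c 0 = 0 ∧ c (Fin.last (i + 1)) = n := by
  induction i with
  | zero =>
    have : c = ![0, n] := h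
    subst this
    refine ⟨Fin.monotone_iff_le_succ.2 fun j => ?_, rfl, rfl⟩
    fin_cases j
    simp
  | succ i ih =>
    obtain ⟨c, τ, σ, hc, hτ, -, rfl⟩ := h
    obtain ⟨hm, h0, h1⟩ := ih hc
    refine ⟨Fin.monotone_iff_le_succ.2 (insertNth_rel (Fin.monotone_iff_le_succ.1 hm) ?_ ?_),
      ?_, ?_⟩
    · omega
    · have h2 := (hτ (σ (Fin.last i))).le hδ
      have h3 := hm (Fin.castSucc_le_succ (σ (Fin.last i)))
      omega
    · rw [insertNth_castSucc_succ_zero, h0]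
    · rw [insertNth_castSucc_succ_last, h1]

theorem IsStage.le {H : Type*} {δ : ℕ → ℝ} (hδ : ∀ n, 1 ≤ n → δ n ∈ Set.Ioo (0 : ℝ) 1)
    {k : H → H → ℝ} {z : ℕ → H} {n i : ℕ} {c : Fin (i + 2) → ℕ} (h : IsStage δ k z n i c)
    (j : Fin (i + 2)) : c j ≤ n := by
  obtain ⟨hm, -, h1⟩ := h.monotone hδ
  rw [← h1]
  exact hm (Fin.le_last j)

/-! ### The algorithm can be carried out -/

/-- Both halves of an admissible split of a long segment are long. -/
theorem eventually_splitRange_nonempty {δ : ℕ → ℝ} (hδ : ∀ n, 1 ≤ n → δ n ∈ Set.Ioo (0 : ℝ) 1)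
    (hδ0 : Tendsto δ atTop (𝓝 0))
    (hδn : Tendsto (fun n : ℕ => (n : ℝ) * δ n) atTop atTop) (L : ℕ) :
    ∀ᶠ m in atTop, (splitRange δ m).Nonempty ∧ ∀ t ∈ splitRange δ m, L ≤ t ∧ t + L ≤ m := by
  filter_upwards [hδ0.eventually_lt_const (show (0 : ℝ) < 1 / 4 by norm_num),
    hδn.eventually_ge_atTop (L : ℝ), eventually_ge_atTop 2] with m h1 h2 h3
  have h3' : (2 : ℝ) ≤ m := by exact_mod_cast h3
  obtain ⟨hd0, hd1⟩ := hδ m (by omega)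
  constructor
  · refine Finset.nonempty_Icc.2 (Nat.le_floor ?_)
    have := Nat.ceil_lt_add_one (show 0 ≤ (m : ℝ) * δ m by positivity)
    nlinarith
  · intro t ht
    obtain ⟨ha, hb⟩ := Finset.mem_Icc.1 ht
    have ha' := Nat.ceil_le.1 ha
    have hb' : (t : ℝ) ≤ m * (1 - δ m) :=
      (Nat.cast_le.2 hb).trans (Nat.floor_le (mul_nonneg (by positivity) (by linarith)))
    constructor
    · exact_mod_cast h2.trans ha'
    · have : (t : ℝ) + L ≤ m := by linarith
      exact_mod_cast this

/-- The lower bound `L` on the lengths of the segments is what the induction needs: long segments can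
be split again into long ones. -/
theorem eventually_exists_isStage {H : Type*} (k : H → H → ℝ) {δ : ℕ → ℝ}
    (hδ : ∀ n, 1 ≤ n → δ n ∈ Set.Ioo (0 : ℝ) 1) (hδ0 : Tendsto δ atTop (𝓝 0))
    (hδn : Tendsto (fun n : ℕ => (n : ℝ) * δ n) atTop atTop) (i L : ℕ) :
    ∀ᶠ n in atTop, ∀ z : ℕ → H, ∃ c, IsStage δ k z n i c ∧
      ∀ j : Fin (i + 1), c j.castSucc + L ≤ c j.succ := by
  induction i generalizing L with
  | zero =>
    filter_upwards [eventually_ge_atTop L] with n hn z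
    refine ⟨![0, n], rfl, fun j => ?_⟩
    fin_cases j
    simpa using hn
  | succ i ih =>
    obtain ⟨M, hM⟩ := eventually_atTop.1 (eventually_splitRange_nonempty hδ hδ0 hδn L)
    filter_upwards [ih (max M L)] with n hn z
    obtain ⟨c, hc, hgap⟩ := hn z
    have hgap' : ∀ j : Fin (i + 1), M ≤ c j.succ - c j.castSucc := fun j => by
      have h1 := hgap j
      have h2 := le_max_left M L
      omega
    have hex : ∀ j : Fin (i + 1), ∃ t, IsCandidate δ k z (c j.castSucc) (c j.succ) t := fun j => by
      obtain ⟨t, ht, hmax⟩ := Finset.exists_max_image _ (splitRho k z (c j.castSucc) (c j.succ))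
        (hM _ (hgap' j)).1
      exact ⟨t, ht, hmax⟩
    choose τ hτ using hex
    let g : Fin (i + 1) → ℝ := fun j => splitRho k z (c j.castSucc) (c j.succ) (τ j)
    refine ⟨_, ⟨c, τ, Tuple.sort g, hc, hτ, Tuple.monotone_sort g, rfl⟩, ?_⟩
    have ht := (hM _ (hgap' (Tuple.sort g (Fin.last i)))).2 _ (hτ (Tuple.sort g (Fin.last i))).1
    have hg := hgap (Tuple.sort g (Fin.last i))
    refine insertNth_rel (r := fun a b : ℕ => a + L ≤ b) (fun j => ?_) ?_ ?_
    · have h1 := hgap j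
      have h2 := le_max_right M L
      omega
    · omega
    · omega

/-! ### Limits along ultrafilters -/

theorem exists_tendsto_div {U : Ultrafilter ℕ} {p : ℕ → ℕ} (hp : ∀ᶠ n in (U : Filter ℕ), p n ≤ n) :
    ∃ x : ℝ, Tendsto (fun n => (p n : ℝ) / n) U (𝓝 x) := by
  have : ∀ᶠ n in (U : Filter ℕ), (p n : ℝ) / n ∈ Set.Icc (0 : ℝ) 1 := by
    filter_upwards [hp] with n hn
    exact ⟨by positivity, div_le_one_of_le₀ (by exact_mod_cast hn) (by positivity)⟩
  obtain ⟨x, -, hx⟩ := (isCompact_Icc (a := (0 : ℝ)) (b := 1)).ultrafilter_le_nhds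
    (U.map fun n => (p n : ℝ) / n) (le_principal_iff.2 this)
  exact ⟨x, hx⟩

theorem eventually_floor_mem_splitRange {δ : ℕ → ℝ} (hδ0 : Tendsto δ atTop (𝓝 0))
    {l : Filter ℕ} (hl : l ≤ atTop) {m : ℕ → ℕ} {r s : ℝ}
    (hm : Tendsto (fun n => (m n : ℝ) / n) l (𝓝 r)) (hs : 0 < s) (hsr : s < r) :
    ∀ᶠ n : ℕ in l, ⌊(n : ℝ) * s⌋₊ ∈ splitRange δ (m n) := by
  have hfloor : Tendsto (fun n : ℕ => (⌊(n : ℝ) * s⌋₊ : ℝ) / n) l (𝓝 s) :=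
    tendsto_floor_mul_div hs.le hl
  have hpos : ∀ᶠ n : ℕ in l, 0 < n := hl (eventually_gt_atTop 0)
  have hmtop : Tendsto m l atTop := by
    rw [← tendsto_natCast_atTop_iff (R := ℝ)]
    have h := hm.pos_mul_atTop (hs.trans hsr) ((tendsto_natCast_atTop_atTop (R := ℝ)).mono_left hl)
    refine h.congr' ?_
    filter_upwards [hpos] with n hn
    field_simp
  have hd := hδ0.comp hmtop
  have h1 : Tendsto (fun n => (m n : ℝ) / n * δ (m n)) l (𝓝 0) := by
    simpa using hm.mul hd
  have h2 : Tendsto (fun n => (m n : ℝ) / n * (1 - δ (m n))) l (𝓝 r) := by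
    simpa using hm.mul (hd.const_sub 1)
  filter_upwards [h1.eventually_lt hfloor hs, hfloor.eventually_lt h2 hsr, hpos] with n h3 h4 hn
  have hn' : (0 : ℝ) < n := by exact_mod_cast hn
  refine Finset.mem_Icc.2 ⟨Nat.ceil_le.2 ?_, Nat.le_floor ?_⟩
  · rw [div_mul_eq_mul_div, div_lt_div_iff_of_pos_right hn'] at h3
    exact h3.le
  · rw [div_mul_eq_mul_div, div_lt_div_iff_of_pos_right hn'] at h4
    exact h4.le

section Consistency

variable {H E : Type*} [NormedAddCommGroup E] [InnerProductSpace ℝ E] {K₀ : ℕ} {k : H → H → ℝ}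
  {z : ℕ → ℕ → H} {γ : Fin (K₀ + 2) → ℝ} {κ : Fin (K₀ + 1) → Fin (K₀ + 1) → ℝ}
  {m : ℕ → ℕ → ℕ → ℝ} {v : Fin (K₀ + 1) → E} {B : ℝ} {δ : ℕ → ℝ}

/-- A limit of candidate split points maximises the limiting criterion. -/
theorem IsGramApprox.splitLimit_le_of_isCandidate (h : IsGramApprox k z γ κ m)
    (hv : ∀ a b, inner ℝ (v a) (v b) = κ a b) (hkB : ∀ x y, |k x y| ≤ B)
    (hδ : ∀ n, 1 ≤ n → δ n ∈ Set.Ioo (0 : ℝ) 1) (hδ0 : Tendsto δ atTop (𝓝 0))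
    {l : Filter ℕ} [l.NeBot] (hl : l ≤ atTop) {a b t : ℕ → ℕ} {x y s : ℝ}
    (hcand : ∀ᶠ n in l, IsCandidate δ k (z n) (a n) (b n) (t n))
    (hab : ∀ᶠ n in l, a n ≤ b n) (hbn : ∀ᶠ n in l, b n ≤ n)
    (ha : Tendsto (fun n => (a n : ℝ) / n) l (𝓝 x))
    (hb : Tendsto (fun n => (b n : ℝ) / n) l (𝓝 y))
    (ht : Tendsto (fun n => (t n : ℝ) / n) l (𝓝 s)) (hxy : x < y) {u : ℝ} (hu : u ∈ Set.Ioo x y) :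
    splitLimit (blockPath γ v) x y u ≤ splitLimit (blockPath γ v) x y (x + s) := by
  have hux : 0 < u - x := sub_pos.2 hu.1
  have hm : Tendsto (fun n => ((b n - a n : ℕ) : ℝ) / n) l (𝓝 (y - x)) := by
    refine (hb.sub ha).congr' ?_
    filter_upwards [hab] with n hn
    rw [Nat.cast_sub hn]
    ring
  have hmem := eventually_floor_mem_splitRange hδ0 hl hm hux (by linarith [hu.2])
  have hfloor : Tendsto (fun n : ℕ => (⌊(n : ℝ) * (u - x)⌋₊ : ℝ) / n) l (𝓝 (u - x)) :=
    tendsto_floor_mul_div hux.le hl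
  have htb : ∀ᶠ n in l, a n + t n ≤ b n := by
    filter_upwards [hcand, hab] with n h1 h2
    have := h1.le hδ
    omega
  have hfb : ∀ᶠ n : ℕ in l, a n + ⌊(n : ℝ) * (u - x)⌋₊ ≤ b n := by
    have := (ha.add hfloor).eventually_lt hb (by linarith [hu.2])
    filter_upwards [this, hl (eventually_gt_atTop 0)] with n h1 hn
    have hn' : (0 : ℝ) < n := by exact_mod_cast hn
    rw [← add_div, div_lt_div_iff_of_pos_right hn'] at h1
    exact_mod_cast h1.le
  have hlim1 := h.tendsto_splitRho hv hkB hl hfb hbn ha hb hfloor hxy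
  have hlim2 := h.tendsto_splitRho hv hkB hl htb hbn ha hb ht hxy
  rw [add_sub_cancel] at hlim1
  refine le_of_tendsto_of_tendsto hlim1 hlim2 ?_
  filter_upwards [hcand, hmem] with n h1 h2 using h1.2 _ h2

theorem trueBreak_injective (hγ : StrictMono γ) : Function.Injective (trueBreak γ) :=
  fun _ _ hij => Fin.succ_injective _ (Fin.castSucc_injective _ (hγ.injective hij))

/-- A grid of `[0, 1]` with fewer than `K₀` interior points leaves a breakfraction in the interior of
one of its intervals. -/
theorem exists_trueBreak_mem_Ioo (hγ : StrictMono γ) (h0 : γ 0 = 0)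
    (h1 : γ (Fin.last (K₀ + 1)) = 1) {i : ℕ} (hi : i < K₀) {x : Fin (i + 2) → ℝ} (hx0 : x 0 = 0)
    (hx1 : x (Fin.last (i + 1)) = 1) :
    ∃ (β : Fin K₀) (j : Fin (i + 1)), x j.castSucc < trueBreak γ β ∧ trueBreak γ β < x j.succ := by
  by_contra! hcon
  have hall : ∀ β : Fin K₀, ∃ l : Fin i, trueBreak γ β = x l.succ.castSucc := by
    intro β
    have hpos : x 0 < trueBreak γ β := by
      rw [hx0, ← h0]
      exact hγ (Fin.pos_iff_ne_zero.2 (Fin.castSucc_ne_zero_iff.2 (Fin.succ_ne_zero β)))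
    have hlt : trueBreak γ β < x (Fin.last (i + 1)) := by
      rw [hx1, ← h1]
      exact hγ (Fin.castSucc_lt_last _)
    rcases exists_mem_Ioo_or_eq_interior x hpos hlt with ⟨j, h2, h3⟩ | h
    · exact absurd h3 (not_lt.2 (hcon β j h2))
    · exact h
  choose f hf using hall
  have hinj : Function.Injective f := fun a b hab => by
    refine trueBreak_injective hγ ?_
    rw [hf a, hf b, hab]
  have := Fintype.card_le_of_injective f hinj
  simp only [Fintype.card_fin] at this
  omega

/-- The choices made in the last iteration, as functions of `n`. The order `σ` of the splits takes
finitely many values and is therefore constant along the ultrafilter. -/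
theorem exists_of_eventually_isStage_succ {U : Ultrafilter ℕ} {i : ℕ} {c' : ℕ → Fin (i + 3) → ℕ}
    (h : ∀ᶠ n in (U : Filter ℕ), IsStage δ k (z n) n (i + 1) (c' n)) :
    ∃ (c : ℕ → Fin (i + 2) → ℕ) (τ : ℕ → Fin (i + 1) → ℕ) (σ : Equiv.Perm (Fin (i + 1))),
      (∀ᶠ n in (U : Filter ℕ), IsStage δ k (z n) n i (c n)) ∧
      (∀ᶠ n in (U : Filter ℕ), ∀ j : Fin (i + 1),
        IsCandidate δ k (z n) (c n j.castSucc) (c n j.succ) (τ n j)) ∧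
      (∀ᶠ n in (U : Filter ℕ), Monotone (fun r : Fin (i + 1) =>
        splitRho k (z n) (c n (σ r).castSucc) (c n (σ r).succ) (τ n (σ r)))) ∧
      ∀ᶠ n in (U : Filter ℕ), c' n = Fin.insertNth (α := fun _ => ℕ) (σ (Fin.last i)).succ.castSucc
        (c n (σ (Fin.last i)).castSucc + τ n (σ (Fin.last i))) (c n) := by
  obtain ⟨c, h⟩ := Eventually.choice h
  obtain ⟨τ, h⟩ := Eventually.choice h
  obtain ⟨σ, h⟩ := Ultrafilter.eventually_exists_iff.1 h
  exact ⟨c, τ, σ, h.mono fun n hn => hn.1, h.mono fun n hn => hn.2.1, h.mono fun n hn => hn.2.2.1,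
    h.mono fun n hn => hn.2.2.2⟩

/-- Along an ultrafilter, the rescaled boundaries after `i ≤ K₀` iterations converge to `0`, `1` and `i`
distinct breakfractions. Strict monotonicity of the limits keeps the limiting segments
nondegenerate, which the next iteration needs. -/
theorem IsGramApprox.exists_tendsto_stage (h : IsGramApprox k z γ κ m)
    (hv : ∀ a b, inner ℝ (v a) (v b) = κ a b) (hvne : ∀ i : Fin K₀, v i.castSucc ≠ v i.succ)
    (hkB : ∀ x y, |k x y| ≤ B)
    (hδ : ∀ n, 1 ≤ n → δ n ∈ Set.Ioo (0 : ℝ) 1) (hδ0 : Tendsto δ atTop (𝓝 0))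
    {U : Ultrafilter ℕ} (hU : (U : Filter ℕ) ≤ atTop) {i : ℕ} (hi : i ≤ K₀)
    {c : ℕ → Fin (i + 2) → ℕ} (hc : ∀ᶠ n in (U : Filter ℕ), IsStage δ k (z n) n i (c n)) :
    ∃ x : Fin (i + 2) → ℝ, (∀ j, Tendsto (fun n => (c n j : ℝ) / n) U (𝓝 (x j))) ∧
      StrictMono x ∧ x 0 = 0 ∧ x (Fin.last (i + 1)) = 1 ∧
      ∀ j, j ≠ 0 → j ≠ Fin.last (i + 1) → x j ∈ Set.range (trueBreak γ) := by
  induction i with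
  | zero =>
    refine ⟨![0, 1], fun j => ?_, ?_, rfl, rfl, fun j hj0 hj1 => ?_⟩
    · have hpos : ∀ᶠ n : ℕ in (U : Filter ℕ), 0 < n := hU (eventually_gt_atTop 0)
      refine tendsto_const_nhds.congr' ?_
      filter_upwards [hc, hpos] with n hn hn0
      have hn' : c n = ![0, n] := hn
      have hn1 : (n : ℝ) ≠ 0 := by positivity
      rw [hn']
      fin_cases j
      · simp
      · simp [hn1]
    · refine Fin.strictMono_iff_lt_succ.2 fun j => ?_
      fin_cases j
      simp
    · fin_cases j
      · exact absurd rfl hj0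
      · exact absurd rfl hj1
  | succ i ih =>
    obtain ⟨c₀, τ, σ, hst, hcand, hmono, heq⟩ := exists_of_eventually_isStage_succ hc
    obtain ⟨x, hx, hxm, hx0, hx1, hxr⟩ := ih (by omega) hst
    have hle : ∀ j : Fin (i + 2), ∀ᶠ n in (U : Filter ℕ), c₀ n j ≤ n := fun j =>
      hst.mono fun n hn => hn.le hδ j
    have hab : ∀ j : Fin (i + 1), ∀ᶠ n in (U : Filter ℕ), c₀ n j.castSucc ≤ c₀ n j.succ := fun j =>
      hst.mono fun n hn => (hn.monotone hδ).1 (Fin.castSucc_le_succ j)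
    have hcj : ∀ j : Fin (i + 1), ∀ᶠ n in (U : Filter ℕ),
        IsCandidate δ k (z n) (c₀ n j.castSucc) (c₀ n j.succ) (τ n j) := fun j =>
      hcand.mono fun n hn => hn j
    have htb : ∀ j : Fin (i + 1), ∀ᶠ n in (U : Filter ℕ),
        c₀ n j.castSucc + τ n j ≤ c₀ n j.succ := fun j => by
      filter_upwards [hcj j, hab j] with n h1 h2
      have := h1.le hδ
      omega
    have hτ : ∀ j : Fin (i + 1), ∃ s : ℝ, Tendsto (fun n => (τ n j : ℝ) / n) U (𝓝 s) := fun j => by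
      refine exists_tendsto_div ?_
      filter_upwards [htb j, hle j.succ] with n h1 h2
      omega
    choose s hs using hτ
    have hxj : ∀ j : Fin (i + 1), x j.castSucc < x j.succ := fun j => hxm (Fin.castSucc_lt_succ)
    let φ : Fin (i + 1) → ℝ → ℝ := fun j => splitLimit (blockPath γ v) (x j.castSucc) (x j.succ)
    have hlim : ∀ j, Tendsto (fun n => splitRho k (z n) (c₀ n j.castSucc) (c₀ n j.succ) (τ n j)) U
        (𝓝 (φ j (x j.castSucc + s j))) := fun j =>
      h.tendsto_splitRho hv hkB hU (htb j) (hle j.succ) (hx _) (hx _) (hs j) (hxj j)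
    have hmax : ∀ j, ∀ u ∈ Set.Ioo (x j.castSucc) (x j.succ),
        φ j u ≤ φ j (x j.castSucc + s j) := fun j u hu =>
      h.splitLimit_le_of_isCandidate hv hkB hδ hδ0 hU (hcj j) (hab j) (hle j.succ) (hx _) (hx _)
        (hs j) (hxj j) hu
    -- The segment that stays split; its limiting value is the largest one.
    set J := σ (Fin.last i) with hJ
    have hbest : ∀ j, φ j (x j.castSucc + s j) ≤ φ J (x J.castSucc + s J) := by
      intro j
      refine le_of_tendsto_of_tendsto (hlim j) (hlim J) ?_
      filter_upwards [hmono] with n hn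
      have := hn (Fin.le_last (σ.symm j))
      simpa only [Equiv.apply_symm_apply, ← hJ] using this
    have hpos : 0 < φ J (x J.castSucc + s J) := by
      obtain ⟨β, j, h1, h2⟩ := exists_trueBreak_mem_Ioo h.strictMono h.zero h.last
        (show i < K₀ by omega) hx0 hx1
      obtain ⟨u, hu, hupos⟩ := exists_splitLimit_pos h.strictMono (hvne β) h1 h2
      exact hupos.trans_le ((hmax j u hu).trans (hbest j))
    have hs0 : 0 ≤ s J := ge_of_tendsto' (hs J) fun n => by positivity
    have hs1 : x J.castSucc + s J ≤ x J.succ := by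
      refine le_of_tendsto_of_tendsto ((hx J.castSucc).add (hs J)) (hx J.succ) ?_
      filter_upwards [htb J] with n hn
      rw [← add_div]
      gcongr
      exact_mod_cast hn
    -- At the ends of the segment the limiting criterion vanishes.
    have hθ0 : x J.castSucc < x J.castSucc + s J := by
      rcases hs0.eq_or_lt with h0 | h0
      · exact absurd hpos (by simp [φ, splitLimit, ← h0])
      · linarith
    have hθ1 : x J.castSucc + s J < x J.succ := by
      rcases hs1.eq_or_lt with h0 | h0
      · exact absurd hpos (by simp [φ, splitLimit, h0])
      · exact h0
    have hmem : ∃ b : Fin K₀, x J.castSucc + s J = γ b.succ.castSucc := by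
      refine exists_eq_of_isMax_splitLimit h.strictMono.monotone v ?_ ?_ hθ0 hθ1 hpos (hmax J)
      · rw [h.zero, ← hx0]
        exact hxm.monotone (Fin.zero_le _)
      · rw [h.last, ← hx1]
        exact hxm.monotone (Fin.le_last _)
    refine ⟨Fin.insertNth (α := fun _ => ℝ) J.succ.castSucc (x J.castSucc + s J) x,
      fun j => ?_, ?_, ?_, ?_, fun j hj0 hj1 => ?_⟩
    · rcases Fin.eq_self_or_eq_succAbove J.succ.castSucc j with rfl | ⟨q, rfl⟩
      · rw [Fin.insertNth_apply_same]
        refine ((hx J.castSucc).add (hs J)).congr' ?_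
        filter_upwards [heq] with n hn
        rw [hn, Fin.insertNth_apply_same]
        push_cast
        ring
      · rw [Fin.insertNth_apply_succAbove]
        refine (hx q).congr' ?_
        filter_upwards [heq] with n hn
        rw [hn, Fin.insertNth_apply_succAbove]
    · exact Fin.strictMono_iff_lt_succ.2 (insertNth_rel (Fin.strictMono_iff_lt_succ.1 hxm) hθ0 hθ1)
    · rw [insertNth_castSucc_succ_zero, hx0]
    · rw [insertNth_castSucc_succ_last, hx1]
    · rcases Fin.eq_self_or_eq_succAbove J.succ.castSucc j with rfl | ⟨q, rfl⟩
      · rw [Fin.insertNth_apply_same]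
        obtain ⟨b, hb⟩ := hmem
        exact ⟨b, hb.symm⟩
      · rw [Fin.insertNth_apply_succAbove]
        exact hxr q ((succAbove_castSucc_succ_ne_zero_iff J q).1 hj0)
          ((succAbove_castSucc_succ_ne_last_iff J q).1 hj1)

theorem IsGramApprox.tendsto_stage_of_le (h : IsGramApprox k z γ κ m)
    (hv : ∀ a b, inner ℝ (v a) (v b) = κ a b) (hvne : ∀ i : Fin K₀, v i.castSucc ≠ v i.succ)
    (hkB : ∀ x y, |k x y| ≤ B)
    (hδ : ∀ n, 1 ≤ n → δ n ∈ Set.Ioo (0 : ℝ) 1) (hδ0 : Tendsto δ atTop (𝓝 0))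
    {U : Ultrafilter ℕ} (hU : (U : Filter ℕ) ≤ atTop) {K : ℕ} (hK : K ≤ K₀)
    {c : ℕ → Fin (K + 2) → ℕ} (hc : ∀ᶠ n in (U : Filter ℕ), IsStage δ k (z n) n K (c n))
    (l : Fin K) :
    ∃ b : Fin K₀, Tendsto (fun n => estBreak n (c n) l) U (𝓝 (trueBreak γ b)) := by
  obtain ⟨x, hx, -, -, -, hxr⟩ := h.exists_tendsto_stage hv hvne hkB hδ hδ0 hU hK hc
  obtain ⟨b, hb⟩ := hxr l.succ.castSucc (Fin.castSucc_ne_zero_iff.2 (Fin.succ_ne_zero l))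
    (Fin.castSucc_lt_last _).ne
  exact ⟨b, by rw [hb]; exact hx _⟩

/-- After `K₀` iterations the limits of the interior boundaries are `K₀` distinct breakfractions, hence
all of them; further iterations keep the boundaries that are already there. -/
theorem IsGramApprox.tendsto_stage_of_ge (h : IsGramApprox k z γ κ m)
    (hv : ∀ a b, inner ℝ (v a) (v b) = κ a b) (hvne : ∀ i : Fin K₀, v i.castSucc ≠ v i.succ)
    (hkB : ∀ x y, |k x y| ≤ B)
    (hδ : ∀ n, 1 ≤ n → δ n ∈ Set.Ioo (0 : ℝ) 1) (hδ0 : Tendsto δ atTop (𝓝 0))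
    {U : Ultrafilter ℕ} (hU : (U : Filter ℕ) ≤ atTop) {K : ℕ} (hK : K₀ ≤ K)
    {c : ℕ → Fin (K + 2) → ℕ} (hc : ∀ᶠ n in (U : Filter ℕ), IsStage δ k (z n) n K (c n))
    (b : Fin K₀) :
    ∃ l : Fin K, Tendsto (fun n => estBreak n (c n) l) U (𝓝 (trueBreak γ b)) := by
  suffices hs : ∃ l : Fin (K + 2), l ≠ 0 ∧ l ≠ Fin.last (K + 1) ∧
      Tendsto (fun n => (c n l : ℝ) / n) U (𝓝 (trueBreak γ b)) by
    obtain ⟨l, hl0, hl1, hl⟩ := hs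
    obtain ⟨q, rfl⟩ := exists_eq_succ_castSucc hl0 hl1
    exact ⟨q, hl⟩
  induction K, hK using Nat.le_induction with
  | base =>
    obtain ⟨x, hx, hxm, -, -, hxr⟩ := h.exists_tendsto_stage hv hvne hkB hδ hδ0 hU le_rfl hc
    have hne0 : ∀ l : Fin K₀, l.succ.castSucc ≠ 0 := fun l =>
      Fin.castSucc_ne_zero_iff.2 (Fin.succ_ne_zero l)
    have hne1 : ∀ l : Fin K₀, l.succ.castSucc ≠ Fin.last (K₀ + 1) := fun l =>
      (Fin.castSucc_lt_last _).ne
    choose f hf using fun l : Fin K₀ => hxr l.succ.castSucc (hne0 l) (hne1 l)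
    have hinj : Function.Injective f := fun i j hij => by
      have : x i.succ.castSucc = x j.succ.castSucc := by rw [← hf i, ← hf j, hij]
      exact Fin.succ_injective _ (Fin.castSucc_injective _ (hxm.injective this))
    obtain ⟨l, rfl⟩ := Finite.surjective_of_injective hinj b
    exact ⟨l.succ.castSucc, hne0 l, hne1 l, by rw [hf l]; exact hx _⟩
  | succ K hK ih =>
    obtain ⟨c₀, τ, σ, hst, -, -, heq⟩ := exists_of_eventually_isStage_succ hc
    obtain ⟨l, hl0, hl1, hl⟩ := ih hst
    refine ⟨(σ (Fin.last K)).succ.castSucc.succAbove l,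
      (succAbove_castSucc_succ_ne_zero_iff _ l).2 hl0,
      (succAbove_castSucc_succ_ne_last_iff _ l).2 hl1, hl.congr' ?_⟩
    filter_upwards [heq] with n hn
    rw [hn, Fin.insertNth_apply_succAbove]

end Consistency

/-! ### The distances between estimated and true breakfractions -/

theorem tendsto_sum_abs_sub_zero {α ι : Type*} [Fintype ι] {l : Filter α} {f : α → ι → ℝ}
    {g : ι → ℝ} (h : ∀ i, Tendsto (fun n => f n i) l (𝓝 (g i))) :
    Tendsto (fun n => ∑ i, |f n i - g i|) l (𝓝 0) := by
  have : Tendsto (fun n => ∑ i, |f n i - g i|) l (𝓝 (∑ _i : ι, |(0 : ℝ)|)) :=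
    tendsto_finsetSum _ fun i _ => by
      have := (h i).sub_const (g i)
      rw [sub_self] at this
      exact this.abs
  simpa using this

theorem iSup_iInf_nonneg {ι ι' : Type*} (d : ι → ι' → ℝ) (hd : ∀ i j, 0 ≤ d i j) :
    0 ≤ ⨆ i, ⨅ j, d i j :=
  Real.iSup_nonneg fun i => Real.iInf_nonneg fun j => hd i j

theorem iSup_iInf_le_sum {ι ι' : Type*} [Fintype ι] (d : ι → ι' → ℝ) (hd : ∀ i j, 0 ≤ d i j)
    (f : ι → ι') : ⨆ i, ⨅ j, d i j ≤ ∑ i, d i (f i) := by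
  refine Real.iSup_le (fun i => ?_) (Finset.sum_nonneg fun i _ => hd _ _)
  have hbdd : BddBelow (Set.range (d i)) := ⟨0, by rintro _ ⟨j, rfl⟩; exact hd i j⟩
  exact (ciInf_le hbdd (f i)).trans
    (Finset.single_le_sum (f := fun i => d i (f i)) (fun i _ => hd _ _) (Finset.mem_univ i))

/-- A characteristic kernel separates the mean embeddings `v`, `w` of distinct measures. -/
theorem ne_of_inner_eq_meanKernel {H E : Type*} [MeasurableSpace H] [NormedAddCommGroup E]
    [InnerProductSpace ℝ E] {k : H → H → ℝ} (hk : IsBoundedCharacteristicKernel k)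
    {P Q : Measure H} [IsProbabilityMeasure P] [IsProbabilityMeasure Q] (hPQ : P ≠ Q) {v w : E}
    (hvv : inner ℝ v v = meanKernel k P P) (hww : inner ℝ w w = meanKernel k Q Q)
    (hvw : inner ℝ v w = meanKernel k P Q) : v ≠ w := by
  rintro rfl
  refine hPQ (hk.characteristic P Q inferInstance inferInstance ?_)
  change meanKernel k P P + meanKernel k Q Q - 2 * meanKernel k P Q = 0
  linarith

theorem IsChangepointModel.ae_isGramApprox {H Ω : Type*} [MeasurableSpace H] [MeasurableSpace Ω]
    {μ : Measure Ω} [IsProbabilityMeasure μ] {k : H → H → ℝ}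
    (hk : Measurable (Function.uncurry k)) {B : ℝ} (hB : 0 < B) (hkB : ∀ x y, |k x y| ≤ B)
    {K₀ : ℕ} {γ : Fin (K₀ + 2) → ℝ} {F : Fin (K₀ + 1) → Measure H} {Z : ℕ → ℕ → Ω → H}
    (hZ : IsChangepointModel μ K₀ γ F Z) :
    ∀ᵐ ω ∂μ, IsGramApprox k (fun n i => Z n i ω) γ (fun a b => meanKernel k (F a) (F b))
      (fun n i j => meanKernel k (μ.map (Z n i)) (μ.map (Z n j))) := by
  filter_upwards [ae_forall_eventually_abs_sum_sum_le hZ.indep hZ.measurable hk hB hkB] with ω hω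
  exact ⟨hZ.strictMono, hZ.gamma_zero, hZ.gamma_last, hω, fun n a b i j h1 h2 h3 h4 => by
    rw [hZ.law n a i h1 h2, hZ.law n b j h3 h4]⟩

end DescS

theorem theorem5p2 {H Ω : Type*} [NormedAddCommGroup H] [InnerProductSpace ℝ H] [CompleteSpace H]
    [TopologicalSpace.SeparableSpace H] [MeasurableSpace H] [BorelSpace H]
    [MeasurableSpace Ω] (μ : Measure Ω) [IsProbabilityMeasure μ]
    (k : H → H → ℝ) (hk : DescS.IsBoundedCharacteristicKernel k)
    (δ : ℕ → ℝ) (hδ : ∀ n, 1 ≤ n → δ n ∈ Set.Ioo (0 : ℝ) 1) (hδ0 : Tendsto δ atTop (𝓝 0))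
    (hδn : Tendsto (fun n : ℕ => (n : ℝ) * δ n) atTop atTop)
    (K₀ : ℕ) (γ : Fin (K₀ + 2) → ℝ) (F : Fin (K₀ + 1) → Measure H) (Z : ℕ → ℕ → Ω → H)
    (hZ : DescS.IsChangepointModel μ K₀ γ F Z) (K : ℕ) (hK : 1 ≤ K) :
    (∀ᶠ n in atTop, ∀ z : ℕ → H, ∃ c, DescS.IsStage δ k z n K c) ∧
    ∀ᵐ ω ∂μ, ∀ c : ℕ → Fin (K + 2) → ℕ,
      (∀ᶠ n in atTop, DescS.IsStage δ k (fun i => Z n i ω) n K (c n)) →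
      (K ≤ K₀ → Tendsto (fun n => ⨆ l : Fin K, ⨅ i : Fin K₀,
        |DescS.estBreak n (c n) l - DescS.trueBreak γ i|) atTop (𝓝 0)) ∧
      (K = K₀ → Tendsto (fun n => Metric.hausdorffDist
        (Set.range (DescS.estBreak n (c n))) (Set.range (DescS.trueBreak γ))) atTop (𝓝 0)) ∧
      (K₀ < K → Tendsto (fun n => ⨆ i : Fin K₀, ⨅ l : Fin K,
        |DescS.estBreak n (c n) l - DescS.trueBreak γ i|) atTop (𝓝 0)) := by
  refine ⟨(DescS.eventually_exists_isStage k hδ hδ0 hδn K 0).mono fun n hn z =>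
    (hn z).imp fun c hc => hc.1, ?_⟩
  obtain ⟨B, hkB'⟩ := hk.bounded
  have hB : 0 < max B 1 := lt_max_of_lt_right one_pos
  have hkB : ∀ x y, |k x y| ≤ max B 1 := fun x y => (hkB' x y).trans (le_max_left _ _)
  filter_upwards [hZ.ae_isGramApprox hk.measurable hB hkB] with ω hω c hc
  obtain ⟨d, v, hv⟩ := hω.exists_inner_eq hk.posSemidef
  have hprob := hZ.isProbabilityMeasure
  have hvne : ∀ i : Fin K₀, v i.castSucc ≠ v i.succ := fun i =>
    DescS.ne_of_inner_eq_meanKernel hk (hZ.ne i) (hv _ _) (hv _ _) (hv _ _)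
  refine ⟨fun hle => ?_, fun heq => ?_, fun hlt => ?_⟩
  · refine (tendsto_iff_ultrafilter _ _ _).2 fun U hU => ?_
    choose b hb using hω.tendsto_stage_of_le hv hvne hkB hδ hδ0 hU hle (hU hc)
    exact squeeze_zero (fun n => DescS.iSup_iInf_nonneg _ fun _ _ => abs_nonneg _)
      (fun n => DescS.iSup_iInf_le_sum _ (fun _ _ => abs_nonneg _) b)
      (DescS.tendsto_sum_abs_sub_zero hb)
  · refine (tendsto_iff_ultrafilter _ _ _).2 fun U hU => ?_
    choose b hb using hω.tendsto_stage_of_le hv hvne hkB hδ hδ0 hU heq.le (hU hc)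
    choose l hl using hω.tendsto_stage_of_ge hv hvne hkB hδ hδ0 hU heq.ge (hU hc)
    have hsum := (DescS.tendsto_sum_abs_sub_zero hb).add
      (DescS.tendsto_sum_abs_sub_zero (f := fun n i => DescS.estBreak n (c n) (l i)) hl)
    rw [add_zero] at hsum
    refine squeeze_zero (fun n => Metric.hausdorffDist_nonneg) (fun n => ?_) hsum
    have h1 : ∀ j, 0 ≤ |DescS.estBreak n (c n) j - DescS.trueBreak γ (b j)| :=
      fun _ => abs_nonneg _
    have h2 : ∀ i, 0 ≤ |DescS.estBreak n (c n) (l i) - DescS.trueBreak γ i| :=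
      fun _ => abs_nonneg _
    refine Metric.hausdorffDist_le_of_mem_dist
      (add_nonneg (Finset.sum_nonneg fun j _ => h1 j) (Finset.sum_nonneg fun i _ => h2 i)) ?_ ?_
    · rintro _ ⟨j, rfl⟩
      refine ⟨_, ⟨b j, rfl⟩, ?_⟩
      rw [Real.dist_eq]
      exact (Finset.single_le_sum (fun j _ => h1 j) (Finset.mem_univ j)).trans
        (le_add_of_nonneg_right (Finset.sum_nonneg fun i _ => h2 i))
    · rintro _ ⟨i, rfl⟩
      refine ⟨_, ⟨l i, rfl⟩, ?_⟩
      rw [Real.dist_eq, abs_sub_comm]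
      exact (Finset.single_le_sum (fun i _ => h2 i) (Finset.mem_univ i)).trans
        (le_add_of_nonneg_left (Finset.sum_nonneg fun j _ => h1 j))
  · refine (tendsto_iff_ultrafilter _ _ _).2 fun U hU => ?_
    choose l hl using hω.tendsto_stage_of_ge hv hvne hkB hδ hδ0 hU hlt.le (hU hc)
    exact squeeze_zero (fun n => DescS.iSup_iInf_nonneg _ fun _ _ => abs_nonneg _)
      (fun n => DescS.iSup_iInf_le_sum _ (fun _ _ => abs_nonneg _) l)
      (DescS.tendsto_sum_abs_sub_zero (f := fun n i => DescS.estBreak n (c n) (l i)) hl)
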